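/- Let $S^2\subset\mathbb R^3$ be the unit sphere with its Lebesgue (surface) measure $dx$, of total mass $4\pi$, and geodesic distance $d(\cdot,\cdot)$, and let $P_\ell$ be the Legendre polynomial of degree $\ell$ normalised by $P_\ell(1)=1$. For integers $\ell\ge 1$, $q\ge 2$ and $1\le r\le q-1$ put $$\mathcal K_\ell(q;r)=\int_{(S^2)^4}P_\ell(\cos d(x_1,x_2))^{r}\,P_\ell(\cos d(x_2,x_3))^{q-r}\,P_\ell(\cos d(x_3,x_4))^{r}\,P_\ell(\cos d(x_1,x_4))^{q-r}\,dx_1dx_2dx_3dx_4 .$$ Then, as $\ell\to\infty$: 1. for $q=3$ and $r=1,2$: $\mathcal K_\ell(q;r)=O(\ell^{-5})$; 2. for $q=4$ and $r=1,2,3$: $\mathcal K_\ell(q;r)=O(\ell^{-4})$; 3. for $q=5,6$ and all $r=1,\dots,q-1$: $\mathcal K_\ell(q;r)=O(\ell^{-9/2}\log\ell)$; 4. for $q\ge 7$: $\mathcal K_\ell(q;1)=\mathcal K_\ell(q;q-1)=O(\ell^{-9/2})$, and $\mathcal K_\ell(q;r)=O(\ell^{-5})$ for $r=2,\dots,q-2$.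 Here $a_\ell=O(b_\ell)$ means that $|a_\ell|\le C\,b_\ell$ for all integers $\ell\ge 1$ (for all $\ell\ge 2$ in item 3, where $b_1=0$), and the constant $C$ is absolute: it does not depend on $\ell$, $q$ or $r$. -/

import Mathlib

open MeasureTheory

noncomputable section

/-- The Legendre polynomial `P_ℓ` of degree `ℓ`, normalised by `P_ℓ(1) = 1`, through the Rodrigues
formula `P_ℓ(t) = (2^ℓ ℓ!)⁻¹ (d/dt)^ℓ (t² - 1)^ℓ`. -/
def legendreP (ℓ : ℕ) : Polynomial ℝ :=
  Polynomial.C (1 / ((2 : ℝ) ^ ℓ * (Nat.factorial ℓ : ℝ))) *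
    Polynomial.derivative^[ℓ] ((Polynomial.X ^ 2 - 1) ^ ℓ)

/-- The unit sphere `S²` in Euclidean `ℝ³`. -/
abbrev S2 : Type := Metric.sphere (0 : EuclideanSpace ℝ (Fin 3)) 1

/-- The Lebesgue (surface) measure on `S²`, of total mass `4π`. -/
def sigmaS2 : Measure S2 := (volume : Measure (EuclideanSpace ℝ (Fin 3))).toSphere

/-- The spherical (geodesic) distance on `S²`: the angle between two unit vectors. -/
def sphDist (x y : S2) : ℝ :=
  InnerProductGeometry.angle (x : EuclideanSpace ℝ (Fin 3)) (y : EuclideanSpace ℝ (Fin 3))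

/-- The kernel `P_ℓ(cos d(x, y))`, the covariance of the Gaussian spherical harmonic of
degree `ℓ` on `S²`. -/
def legendreKernel (ℓ : ℕ) (x y : S2) : ℝ := (legendreP ℓ).eval (Real.cos (sphDist x y))

/-- The contraction integral `K_ℓ(q; r)` on `S²`, for `1 ≤ r ≤ q - 1`: the integral over `(S²)⁴` of
`P_ℓ(cos d(x₁,x₂))^r P_ℓ(cos d(x₂,x₃))^(q-r) P_ℓ(cos d(x₃,x₄))^r P_ℓ(cos d(x₁,x₄))^(q-r)`. -/
def contractionK (ℓ q r : ℕ) : ℝ :=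
  ∫ x : S2 × S2 × S2 × S2,
    legendreKernel ℓ x.1 x.2.1 ^ r * legendreKernel ℓ x.2.1 x.2.2.1 ^ (q - r) *
      legendreKernel ℓ x.2.2.1 x.2.2.2 ^ r * legendreKernel ℓ x.1 x.2.2.2 ^ (q - r)
    ∂(sigmaS2.prod (sigmaS2.prod (sigmaS2.prod sigmaS2)))

end

/-!
Bernstein's inequality `√(1 - x²) P_n(x)² ≤ C / n`, read off from the monotonicity of Sonin's
energy for the Legendre equation, gives `∫ |P_n|^p = O(n^{-p/2})` for every `p < 4`.
The arithmetic-geometric mean inequality removes one edge from the 4-cycle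
`x₁ x₂ x₃ x₄`, and integrating along the remaining path bounds the contraction by a product of
three one-dimensional moments of `|P_n|`. When `r = 1`, the Funk–Hecke formula makes `P_n` an
eigenfunction of convolution with `P_n^{q-1}`, so the contraction equals
`4π (2π ∫ P_n^q)² (2π ∫ P_n²)`. For `q = 3` the cancellation in `∫ P_n³ = O(n⁻²)` comes from
integrating the Legendre equation by parts.
-/

open Polynomial

section PolynomialCalculus

theorem iterate_derivative_comp_neg_X {R : Type*} [CommRing R] (p : R[X]) (k : ℕ) :
    derivative^[k] (p.comp (-X)) = (-1) ^ k * (derivative^[k] p).comp (-X) := by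
  induction k generalizing p with
  | zero => simp
  | succ k ih =>
    rw [Function.iterate_succ_apply, derivative_comp, Function.iterate_succ_apply]
    simp only [derivative_neg, derivative_X, neg_mul, one_mul, iterate_derivative_neg, ih]
    ring

theorem integral_eval_derivative (p : ℝ[X]) (a b : ℝ) :
    ∫ x in a..b, (derivative p).eval x = p.eval b - p.eval a :=
  intervalIntegral.integral_eq_sub_of_hasDerivAt (fun x _ => p.hasDerivAt x)
    ((derivative p).continuous.intervalIntegrable _ _)

theorem integral_eval_derivative_mul {p q : ℝ[X]} {a b : ℝ} (ha : p.eval a = 0)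
    (hb : p.eval b = 0) :
    ∫ x in a..b, (derivative p).eval x * q.eval x =
      -∫ x in a..b, p.eval x * (derivative q).eval x := by
  have h := integral_eval_derivative (p * q) a b
  simp only [derivative_mul, eval_add, eval_mul, ha, hb, zero_mul, sub_zero] at h
  rw [intervalIntegral.integral_add
    (by exact (Continuous.intervalIntegrable (by fun_prop) _ _))
    (by exact (Continuous.intervalIntegrable (by fun_prop) _ _))] at h
  linarith

end PolynomialCalculus

section Rodrigues

theorem eval_iterate_derivative_sq_sub_one_pow_eq_zero {n k : ℕ} (hk : k < n) {x : ℝ}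
    (hx : x ^ 2 = 1) : (derivative^[k] ((X ^ 2 - 1 : ℝ[X]) ^ n)).eval x = 0 := by
  have h0 : ((X ^ 2 - 1 : ℝ[X]) ^ (n - k)).eval x = 0 := by
    simp [hx, (Nat.sub_pos_of_lt hk).ne']
  exact eval_eq_zero_of_dvd_of_eval_eq_zero
    (pow_sub_dvd_iterate_derivative_pow (X ^ 2 - 1 : ℝ[X]) n k) h0

theorem integral_iterate_derivative_sq_sub_one_pow_mul {n k : ℕ} (hk : k ≤ n) (q : ℝ[X]) :
    ∫ x in (-1 : ℝ)..1, (derivative^[n] ((X ^ 2 - 1 : ℝ[X]) ^ n)).eval x * q.eval x =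
      (-1) ^ k * ∫ x in (-1 : ℝ)..1, (derivative^[n - k] ((X ^ 2 - 1 : ℝ[X]) ^ n)).eval x *
        (derivative^[k] q).eval x := by
  induction k with
  | zero => simp
  | succ k ih =>
    have hlt : n - (k + 1) < n := by lia
    rw [ih (by lia), show n - k = n - (k + 1) + 1 by lia, Function.iterate_succ_apply',
      integral_eval_derivative_mul
        (eval_iterate_derivative_sq_sub_one_pow_eq_zero hlt (by norm_num))
        (eval_iterate_derivative_sq_sub_one_pow_eq_zero hlt (by norm_num)),
      Function.iterate_succ_apply']
    ring

theorem integral_legendreP_mul_eq_zero {n : ℕ} {q : ℝ[X]} (hq : q.natDegree < n) :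
    ∫ x in (-1 : ℝ)..1, (legendreP n).eval x * q.eval x = 0 := by
  simp only [legendreP, eval_mul, eval_C, mul_assoc, intervalIntegral.integral_const_mul]
  rw [integral_iterate_derivative_sq_sub_one_pow_mul le_rfl, iterate_derivative_eq_zero hq]
  simp

theorem natDegree_legendreP_le (n : ℕ) : (legendreP n).natDegree ≤ n := by
  rw [legendreP]
  refine (natDegree_C_mul_le _ _).trans ((natDegree_iterate_derivative _ _).trans ?_)
  have : ((X ^ 2 - 1 : ℝ[X]) ^ n).natDegree ≤ n * 2 :=
    natDegree_pow_le_of_le n (by compute_degree)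
  lia

theorem legendreP_eval_one (n : ℕ) : (legendreP n).eval 1 = 1 := by
  have hw : (X ^ 2 - 1 : ℝ[X]) ^ n = (X - C 1) ^ n * (X + C 1) ^ n := by
    rw [← mul_pow, C_1]; ring
  rw [legendreP, hw, iterate_derivative_mul, eval_C_mul, eval_finsetSum,
    Finset.sum_eq_single_of_mem 0 (by simp)]
  · rw [tsub_zero, iterate_derivative_X_sub_pow_self]
    simp [one_add_one_eq_two]
    field_simp
  · intro k hk hk0
    have : n - (n - k) ≠ 0 := by
      rw [Finset.mem_range] at hk; lia
    rw [iterate_derivative_X_sub_pow]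
    simp [this]

theorem integral_one_sub_mul_sq_pos {p : ℝ[X]} (hp : p ≠ 0) :
    0 < ∫ x in (-1 : ℝ)..1, (1 - x) * p.eval x ^ 2 := by
  obtain ⟨c, hc, hpc⟩ : ∃ c ∈ Set.Ioo (-1 : ℝ) 1, p.eval c ≠ 0 := by
    by_contra! h
    exact hp (eq_zero_of_infinite_isRoot p ((Set.Ioo_infinite (by norm_num)).mono h))
  refine intervalIntegral.integral_pos (by norm_num) (by fun_prop) (fun x hx => ?_)
    ⟨c, Set.Ioo_subset_Icc_self hc, ?_⟩
  · exact mul_nonneg (by linarith [hx.2]) (sq_nonneg _)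
  · exact mul_pos (by linarith [hc.2]) (sq_pos_of_ne_zero hpc)

theorem eq_C_mul_legendreP_of_orthogonal {n : ℕ} {g : ℝ[X]} (hg : g.natDegree ≤ n)
    (horth : ∀ q : ℝ[X], q.natDegree < n → ∫ x in (-1 : ℝ)..1, g.eval x * q.eval x = 0) :
    g = C (g.eval 1) * legendreP n := by
  set d := g - C (g.eval 1) * legendreP n with hd
  have hdeg : d.natDegree ≤ n := (natDegree_sub_le_of_le hg
    ((natDegree_C_mul_le _ _).trans (natDegree_legendreP_le n))).trans (max_self n).le
  obtain ⟨e, he⟩ : X - C 1 ∣ d := by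
    rw [dvd_iff_isRoot, IsRoot, hd]
    simp [legendreP_eval_one]
  suffices e = 0 by rw [← sub_eq_zero, ← hd, he, this, mul_zero]
  by_contra he0
  have hedeg : e.natDegree < n := by
    rw [he, natDegree_mul (X_sub_C_ne_zero 1) he0, natDegree_X_sub_C] at hdeg
    lia
  refine (integral_one_sub_mul_sq_pos he0).ne' ?_
  calc ∫ x in (-1 : ℝ)..1, (1 - x) * e.eval x ^ 2
      = ∫ x in (-1 : ℝ)..1, g.eval 1 * ((legendreP n).eval x * e.eval x) -
          g.eval x * e.eval x := by
        refine intervalIntegral.integral_congr fun x _ => ?_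
        have hx := congrArg (eval x) (hd.symm.trans he)
        simp only [eval_sub, eval_mul, eval_C, eval_X] at hx
        linear_combination e.eval x * hx
    _ = 0 := by
        rw [intervalIntegral.integral_sub (Continuous.intervalIntegrable (by fun_prop) _ _)
          (Continuous.intervalIntegrable (by fun_prop) _ _),
          intervalIntegral.integral_const_mul, horth e hedeg,
          integral_legendreP_mul_eq_zero hedeg, mul_zero, sub_zero]

theorem legendreP_ode (n : ℕ) :
    (1 - X ^ 2) * derivative (derivative (legendreP n)) =
      2 * X * derivative (legendreP n) - (n : ℝ[X]) * ((n : ℝ[X]) + 1) * legendreP n := by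
  -- The identity is `derivative^[n + 1]` of `(X² - 1) w' = 2 n X w`.
  set w : ℝ[X] := (X ^ 2 - 1) ^ n with hw
  have hw1 : (X ^ 2 - 1) * derivative w = 2 * (n : ℝ[X]) * (X * w) := by
    rcases n with _ | n
    · simp [hw]
    · simp only [hw, derivative_pow, derivative_sub, derivative_X, derivative_one]
      simp only [map_natCast, Nat.add_sub_cancel]
      push_cast
      ring
  have hw2 : derivative^[2] w * X ^ 2 - derivative^[2] w =
      ((2 * n : ℕ) : ℝ[X]) * w + ((2 * n : ℕ) : ℝ[X]) * (derivative w * X) -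
        ((2 : ℕ) : ℝ[X]) * (derivative w * X) := by
    have h := congrArg derivative hw1
    simp only [derivative_mul, derivative_sub, derivative_pow, derivative_X, derivative_one,
      derivative_natCast, derivative_ofNat] at h
    rw [Function.iterate_succ_apply', Function.iterate_one]
    simp only [map_natCast] at h
    push_cast at h ⊢
    linear_combination h
  have h := congrArg (derivative^[n]) hw2
  simp only [iterate_derivative_sub, iterate_map_add, iterate_derivative_natCast_mul,
    iterate_derivative_derivative_mul_X, iterate_derivative_derivative_mul_X_sq] at h
  have hn : ((n * (n - 1) : ℕ) : ℝ[X]) = n * (n - 1) := by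
    cases n <;> simp
  rw [← Function.iterate_add_apply] at h
  simp only [Function.iterate_succ_apply', nsmul_eq_mul, hn] at h
  push_cast at h
  rw [legendreP, ← hw]
  simp only [derivative_C_mul]
  linear_combination (-C (1 / ((2 : ℝ) ^ n * (Nat.factorial n : ℝ)))) * h

end Rodrigues

section Parity

theorem legendreP_comp_neg_X (n : ℕ) : (legendreP n).comp (-X) = C ((-1) ^ n) * legendreP n := by
  have hw : ((X ^ 2 - 1 : ℝ[X]) ^ n).comp (-X) = (X ^ 2 - 1) ^ n := by simp
  have h := iterate_derivative_comp_neg_X ((X ^ 2 - 1 : ℝ[X]) ^ n) n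
  have hsq : ((-1 : ℝ[X]) ^ n) * (-1) ^ n = 1 := by rw [← mul_pow]; simp
  simp only [legendreP, mul_comp, C_comp, C_pow, C_neg, C_1]
  rw [hw] at h
  nth_rewrite 2 [h]
  linear_combination (-C (1 / ((2 : ℝ) ^ n * (Nat.factorial n : ℝ))) *
     (derivative^[n] ((X ^ 2 - 1 : ℝ[X]) ^ n)).comp (-X)) * hsq

theorem abs_legendreP_eval_neg (n : ℕ) (x : ℝ) :
    |(legendreP n).eval (-x)| = |(legendreP n).eval x| := by
  have h := congrArg (fun p => |eval x p|) (legendreP_comp_neg_X n)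
  simpa [abs_mul] using h

theorem abs_derivative_legendreP_eval_neg (n : ℕ) (x : ℝ) :
    |(derivative (legendreP n)).eval (-x)| = |(derivative (legendreP n)).eval x| := by
  have h := congrArg (fun p => |eval x (derivative p)|) (legendreP_comp_neg_X n)
  simpa only [derivative_comp, derivative_C_mul, derivative_neg, derivative_X, eval_mul, eval_comp,
    eval_neg, eval_X, eval_C, eval_one, abs_mul, abs_neg, abs_pow, abs_one, one_pow, one_mul]
    using h

theorem integral_eq_two_mul_integral_of_even {f : ℝ → ℝ} {a : ℝ}
    (hf : IntervalIntegrable f volume 0 a) (heven : Function.Even f) :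
    ∫ x in -a..a, f x = 2 * ∫ x in 0..a, f x := by
  have hf' : IntervalIntegrable f volume (-a) 0 := by
    simpa only [zero_sub, sub_zero, heven _] using hf.symm.comp_sub_left 0
  have h := intervalIntegral.integral_comp_neg (a := 0) (b := a) f
  simp only [heven _, neg_zero] at h
  rw [← intervalIntegral.integral_add_adjacent_intervals hf' hf, ← h, two_mul]

end Parity

section ValuesAtZero

theorem centralBinom_sq_mul_le (m : ℕ) : m.centralBinom ^ 2 * (2 * m + 1) ≤ 16 ^ m := by
  induction m with
  | zero => simp
  | succ m ih =>
    refine Nat.le_of_mul_le_mul_left ?_ (show 0 < (m + 1) ^ 2 by positivity)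
    calc (m + 1) ^ 2 * ((m + 1).centralBinom ^ 2 * (2 * (m + 1) + 1))
        = ((m + 1) * (m + 1).centralBinom) ^ 2 * (2 * m + 3) := by ring
      _ = 4 * ((2 * m + 1) * (2 * m + 3)) * (m.centralBinom ^ 2 * (2 * m + 1)) := by
        rw [Nat.succ_mul_centralBinom_succ]; ring
      _ ≤ 4 * (4 * (m + 1) ^ 2) * 16 ^ m := by
        exact Nat.mul_le_mul (Nat.mul_le_mul_left _ (by nlinarith)) ih
      _ = (m + 1) ^ 2 * 16 ^ (m + 1) := by ring

theorem choose_sq_mul_succ_le (n k : ℕ) : n.choose k ^ 2 * (n + 1) ≤ 4 ^ n := by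
  have hmid : n.choose k ^ 2 * (n + 1) ≤ n.choose (n / 2) ^ 2 * (n + 1) := by
    gcongr
    exact Nat.choose_le_middle k n
  refine hmid.trans ?_
  obtain ⟨m, rfl | rfl⟩ := Nat.even_or_odd' n
  · have h := centralBinom_sq_mul_le m
    rwa [Nat.mul_div_cancel_left m two_pos, pow_mul, ← Nat.centralBinom_eq_two_mul_choose]
  · have h := centralBinom_sq_mul_le (m + 1)
    have hc : (m + 1).centralBinom = 2 * (2 * m + 1).choose m := by
      rw [Nat.centralBinom_eq_two_mul_choose, show 2 * (m + 1) = (2 * m + 1) + 1 by ring,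
        Nat.choose_succ_succ, ← Nat.choose_symm_half m]
      ring
    rw [hc, pow_succ 16] at h
    rw [show (2 * m + 1) / 2 = m by lia, pow_succ 4, pow_mul]
    norm_num
    nlinarith [sq_nonneg ((2 * m + 1).choose m)]

theorem coeff_sq_sub_one_pow_sq_mul_le (n m : ℕ) :
    ((X ^ 2 - 1 : ℝ[X]) ^ n).coeff m ^ 2 * (n + 1) ≤ 4 ^ n := by
  have hexp : (X ^ 2 - 1 : ℝ[X]) ^ n = expand ℝ 2 ((X + C (-1)) ^ n) := by simp [sub_eq_add_neg]
  rw [hexp, coeff_expand two_pos]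
  split_ifs
  · have h : ((n.choose (m / 2) : ℝ)) ^ 2 * (n + 1) ≤ 4 ^ n := by
      exact_mod_cast choose_sq_mul_succ_le n (m / 2)
    rw [coeff_X_add_C_pow, mul_pow, ← pow_mul, mul_comm (n - m / 2) 2, pow_mul]
    simpa using h
  · simp

theorem legendreP_eval_zero_sq_mul_le (n : ℕ) : (legendreP n).eval 0 ^ 2 * (n + 1) ≤ 1 := by
  have h := coeff_sq_sub_one_pow_sq_mul_le n n
  rw [← coeff_zero_eq_eval_zero, legendreP, coeff_C_mul, coeff_iterate_derivative]
  simp only [zero_add, Nat.descFactorial_self, nsmul_eq_mul]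
  rw [show (4 : ℝ) ^ n = (2 ^ n) ^ 2 by rw [pow_right_comm]; norm_num] at h
  field_simp
  linarith

theorem derivative_legendreP_eval_zero_sq_le (n : ℕ) :
    (derivative (legendreP n)).eval 0 ^ 2 ≤ n + 1 := by
  have h := coeff_sq_sub_one_pow_sq_mul_le n (n + 1)
  have hdesc : (n + 1).descFactorial n = (n + 1) * n.factorial := by
    simpa [Nat.factorial_succ] using Nat.factorial_mul_descFactorial n.le_succ
  rw [show (4 : ℝ) ^ n = (2 ^ n) ^ 2 by rw [pow_right_comm]; norm_num] at h
  rw [← coeff_zero_eq_eval_zero, coeff_derivative, legendreP, coeff_C_mul,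
    coeff_iterate_derivative, zero_add, add_comm 1 n, hdesc, nsmul_eq_mul]
  push_cast
  set c := ((X ^ 2 - 1 : ℝ[X]) ^ n).coeff (n + 1)
  calc (1 / ((2 : ℝ) ^ n * n.factorial) * ((n + 1) * n.factorial * c) * (0 + 1)) ^ 2
      = ((n : ℝ) + 1) * (c ^ 2 * (n + 1)) / (2 ^ n) ^ 2 := by field_simp; ring
    _ ≤ (n : ℝ) + 1 := by
      rw [div_le_iff₀ (by positivity)]
      gcongr

end ValuesAtZero

section EnergyBounds

theorem legendreP_ode_eval (n : ℕ) (x : ℝ) :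
    (1 - x ^ 2) * (derivative (derivative (legendreP n))).eval x =
      2 * x * (derivative (legendreP n)).eval x - n * (n + 1) * (legendreP n).eval x := by
  simpa using congrArg (eval x) (legendreP_ode n)

theorem legendreP_energy_le (n : ℕ) {x : ℝ} (hx0 : 0 ≤ x) (hx1 : x ≤ 1) :
    n * (n + 1) * (legendreP n).eval x ^ 2 + (1 - x ^ 2) * (derivative (legendreP n)).eval x ^ 2
      ≤ n * (n + 1) := by
  set E : ℝ[X] := (n : ℝ[X]) * ((n : ℝ[X]) + 1) * legendreP n ^ 2 +
    (1 - X ^ 2) * derivative (legendreP n) ^ 2 with hE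
  have hderiv : derivative E = 2 * X * derivative (legendreP n) ^ 2 := by
    simp only [hE, derivative_mul, derivative_sub, derivative_one, derivative_add,
      derivative_pow, derivative_natCast, derivative_X, Nat.cast_ofNat, map_ofNat,
      Nat.add_one_sub_one, pow_one]
    linear_combination (2 * derivative (legendreP n)) * legendreP_ode n
  have hmono : MonotoneOn (fun y => E.eval y) (Set.Icc 0 1) := by
    refine monotoneOn_of_deriv_nonneg (convex_Icc 0 1) (by fun_prop) (by fun_prop) fun y hy => ?_
    rw [interior_Icc] at hy
    rw [Polynomial.deriv, hderiv]
    simp only [eval_mul, eval_pow, eval_X, eval_ofNat]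
    have := hy.1
    positivity
  simpa [hE, legendreP_eval_one] using hmono ⟨hx0, hx1⟩ (Set.right_mem_Icc.mpr zero_le_one) hx1

theorem one_sub_sq_mul_derivative_legendreP_sq_le (n : ℕ) {x : ℝ} (hx0 : 0 ≤ x) (hx1 : x ≤ 1) :
    (1 - x ^ 2) * (derivative (legendreP n)).eval x ^ 2 ≤ n * (n + 1) := by
  refine le_trans (le_add_of_nonneg_left ?_) (legendreP_energy_le n hx0 hx1)
  positivity

theorem abs_legendreP_le_one (n : ℕ) {x : ℝ} (hx : |x| ≤ 1) : |(legendreP n).eval x| ≤ 1 := by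
  wlog hx0 : 0 ≤ x generalizing x
  · rw [← abs_legendreP_eval_neg]
    exact this (by rwa [abs_neg]) (by linarith)
  rw [abs_of_nonneg hx0] at hx
  rcases n.eq_zero_or_pos with rfl | hn
  · simp [legendreP]
  have henergy := legendreP_energy_le n hx0 hx
  have hderiv : 0 ≤ (1 - x ^ 2) * (derivative (legendreP n)).eval x ^ 2 :=
    mul_nonneg (by nlinarith) (sq_nonneg _)
  have hpos : (0 : ℝ) < n * (n + 1) := by positivity
  rw [← sq_le_one_iff_abs_le_one]
  exact le_of_mul_le_mul_left (by linarith) hpos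

end EnergyBounds

section Amplitude

/-- Sonin's function of `v(θ) = √(sin θ) P_n(cos θ)`, in the variable `x = cos θ`: since
`v'' + φ v = 0` with `φ = (n + 1/2)² + 1 / (4 sin² θ)`, it is `v² + v'² / φ`. -/
noncomputable def legendreAmplitude (n : ℕ) (x : ℝ) : ℝ :=
  √(1 - x ^ 2) * ((legendreP n).eval x ^ 2 +
    (x * (legendreP n).eval x - 2 * (1 - x ^ 2) * (derivative (legendreP n)).eval x) ^ 2 /
      ((2 * n + 1) ^ 2 * (1 - x ^ 2) + 1))

theorem hasDerivAt_legendreAmplitude (n : ℕ) {x : ℝ} (hx : 0 < 1 - x ^ 2) :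
    HasDerivAt (legendreAmplitude n)
      (-(2 * x * (x * (legendreP n).eval x -
          2 * (1 - x ^ 2) * (derivative (legendreP n)).eval x) ^ 2 /
        (√(1 - x ^ 2) * ((2 * n + 1) ^ 2 * (1 - x ^ 2) + 1) ^ 2))) x := by
  have hode := legendreP_ode_eval n x
  set P := legendreP n
  have hs : HasDerivAt (fun y : ℝ => 1 - y ^ 2) (-(2 * x)) x := by
    simpa using (hasDerivAt_pow 2 x).const_sub 1
  have hD : (2 * (n : ℝ) + 1) ^ 2 * (1 - x ^ 2) + 1 ≠ 0 := by positivity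
  have hV : HasDerivAt (fun y => y * P.eval y - 2 * (1 - y ^ 2) * (derivative P).eval y)
      ((2 * n * (n + 1) + 1) * P.eval x + x * (derivative P).eval x) x := by
    refine (((hasDerivAt_id' x).mul (P.hasDerivAt x)).sub
      ((hs.const_mul 2).mul ((derivative P).hasDerivAt x))).congr_deriv ?_
    linear_combination (-2) * hode
  refine ((hs.sqrt hx.ne').mul (((P.hasDerivAt x).pow 2).add ((hV.pow 2).div
    ((hs.const_mul ((2 * (n : ℝ) + 1) ^ 2)).add_const 1) hD))).congr_deriv ?_
  simp only [Pi.pow_apply, Pi.add_apply, Pi.div_apply]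
  have hsq : √(1 - x ^ 2) ^ 2 = 1 - x ^ 2 := Real.sq_sqrt hx.le
  have hsq0 : √(1 - x ^ 2) ≠ 0 := (Real.sqrt_pos.mpr hx).ne'
  field_simp
  rw [hsq]
  ring

theorem one_sub_sq_pos {x : ℝ} (hx0 : 0 ≤ x) (hx1 : x < 1) : 0 < 1 - x ^ 2 := by nlinarith

theorem antitoneOn_legendreAmplitude (n : ℕ) : AntitoneOn (legendreAmplitude n) (Set.Ico 0 1) := by
  have hderiv {x : ℝ} (hx : x ∈ Set.Ico (0 : ℝ) 1) :=
    hasDerivAt_legendreAmplitude n (one_sub_sq_pos hx.1 hx.2)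
  refine antitoneOn_of_deriv_nonpos (convex_Ico 0 1)
    (fun x hx => (hderiv hx).continuousAt.continuousWithinAt)
    (fun x hx => (hderiv (interior_subset hx)).differentiableAt.differentiableWithinAt)
    fun x hx => ?_
  have hx := interior_subset hx
  have hx0 := hx.1
  rw [(hderiv hx).deriv, neg_nonpos]
  positivity

theorem legendreAmplitude_zero_le {n : ℕ} (hn : 1 ≤ n) : legendreAmplitude n 0 ≤ 2 / n := by
  have hn' : (1 : ℝ) ≤ n := by exact_mod_cast hn
  have hP : (legendreP n).eval 0 ^ 2 ≤ 1 / n := by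
    rw [le_div_iff₀ (by positivity)]
    nlinarith [legendreP_eval_zero_sq_mul_le n, sq_nonneg ((legendreP n).eval 0)]
  have hP' : (2 * (derivative (legendreP n)).eval 0) ^ 2 / ((2 * n + 1) ^ 2 + 1) ≤ 1 / (n : ℝ) := by
    rw [div_le_div_iff₀ (by positivity) (by positivity)]
    nlinarith [derivative_legendreP_eval_zero_sq_le n]
  calc legendreAmplitude n 0
      = (legendreP n).eval 0 ^ 2 +
          (2 * (derivative (legendreP n)).eval 0) ^ 2 / ((2 * n + 1) ^ 2 + 1) := by
        simp [legendreAmplitude]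
    _ ≤ 1 / n + 1 / n := add_le_add hP hP'
    _ = 2 / n := by ring

theorem legendreAmplitude_le {n : ℕ} (hn : 1 ≤ n) {x : ℝ} (hx0 : 0 ≤ x) (hx1 : x < 1) :
    legendreAmplitude n x ≤ 2 / n :=
  (antitoneOn_legendreAmplitude n (Set.left_mem_Ico.mpr one_pos) ⟨hx0, hx1⟩ hx0).trans
    (legendreAmplitude_zero_le hn)

theorem sqrt_one_sub_sq_mul_legendreP_sq_le {n : ℕ} (hn : 1 ≤ n) {x : ℝ} (hx0 : 0 ≤ x)
    (hx1 : x < 1) : √(1 - x ^ 2) * (legendreP n).eval x ^ 2 ≤ 2 / n := by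
  have hs := one_sub_sq_pos hx0 hx1
  refine le_trans ?_ (legendreAmplitude_le hn hx0 hx1)
  rw [legendreAmplitude]
  gcongr
  exact le_add_of_nonneg_right (by positivity)

theorem sqrt_one_sub_sq_mul_derivative_legendreP_sq_le {n : ℕ} (hn : 1 ≤ n) {x : ℝ}
    (hx0 : 0 ≤ x) (hx1 : x < 1) (hx : 1 ≤ n ^ 2 * (1 - x ^ 2)) :
    √(1 - x ^ 2) * (1 - x ^ 2) * (derivative (legendreP n)).eval x ^ 2 ≤ 11 * n := by
  have hn' : (1 : ℝ) ≤ n := by exact_mod_cast hn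
  have hs := one_sub_sq_pos hx0 hx1
  have hP := sqrt_one_sub_sq_mul_legendreP_sq_le hn hx0 hx1
  have hV : √(1 - x ^ 2) * (x * (legendreP n).eval x -
      2 * (1 - x ^ 2) * (derivative (legendreP n)).eval x) ^ 2 ≤
      2 / n * ((2 * n + 1) ^ 2 * (1 - x ^ 2) + 1) := by
    rw [← div_le_iff₀ (by positivity), mul_div_assoc]
    refine le_trans ?_ (legendreAmplitude_le hn hx0 hx1)
    rw [legendreAmplitude]
    gcongr
    exact le_add_of_nonneg_left (sq_nonneg _)
  set s := 1 - x ^ 2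
  set P := (legendreP n).eval x
  set P' := (derivative (legendreP n)).eval x
  have hsplit : (2 * s * P') ^ 2 ≤ 2 * (x * P - 2 * s * P') ^ 2 + 2 * P ^ 2 := by
    nlinarith [sq_nonneg (2 * (x * P) - 2 * s * P'), mul_nonneg hs.le (sq_nonneg P)]
  refine le_of_mul_le_mul_left ?_ (show 0 < 4 * s by positivity)
  calc 4 * s * (√s * s * P' ^ 2) = √s * (2 * s * P') ^ 2 := by ring
    _ ≤ √s * (2 * (x * P - 2 * s * P') ^ 2 + 2 * P ^ 2) := by gcongr
    _ = 2 * (√s * (x * P - 2 * s * P') ^ 2) + 2 * (√s * P ^ 2) := by ring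
    _ ≤ 2 * (2 / n * ((2 * n + 1) ^ 2 * s + 1)) + 2 * (2 / n) := by gcongr
    _ = 4 * ((2 * n + 1) ^ 2 * s + 2) / n := by ring
    _ ≤ 4 * s * (11 * n) := by
      rw [div_le_iff₀ (by positivity)]
      nlinarith [mul_nonneg (mul_nonneg (by linarith : (0 : ℝ) ≤ n - 1)
        (by linarith : (0 : ℝ) ≤ 5 * n + 1)) hs.le]

end Amplitude

section PowerNorms

theorem legendreP_sq_le {n : ℕ} (hn : 1 ≤ n) {x : ℝ} (hx0 : 0 ≤ x) (hx1 : x < 1) :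
    (legendreP n).eval x ^ 2 ≤ 2 / n * (1 - x) ^ (-(1 / 2) : ℝ) := by
  have hx : 0 < 1 - x := by linarith
  rw [Real.rpow_neg hx.le, ← div_eq_mul_inv, le_div_iff₀ (by positivity), mul_comm,
    ← Real.sqrt_eq_rpow]
  refine le_trans ?_ (sqrt_one_sub_sq_mul_legendreP_sq_le hn hx0 hx1)
  gcongr
  nlinarith

theorem abs_legendreP_rpow_le {n : ℕ} (hn : 1 ≤ n) {p : ℝ} (hp : 0 ≤ p) {x : ℝ} (hx0 : 0 ≤ x)
    (hx1 : x < 1) :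
    |(legendreP n).eval x| ^ p ≤ (2 / n) ^ (p / 2) * (1 - x) ^ (-(p / 4)) := by
  have hx : 0 < 1 - x := by linarith
  calc |(legendreP n).eval x| ^ p = ((legendreP n).eval x ^ 2) ^ (p / 2) := by
        rw [← sq_abs, ← Real.rpow_natCast_mul (abs_nonneg _)]
        congr 1; push_cast; ring
    _ ≤ (2 / n * (1 - x) ^ (-(1 / 2) : ℝ)) ^ (p / 2) := by
        gcongr
        exact legendreP_sq_le hn hx0 hx1
    _ = (2 / n) ^ (p / 2) * (1 - x) ^ (-(p / 4)) := by
        rw [Real.mul_rpow (by positivity) (by positivity), ← Real.rpow_mul hx.le]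
        congr 2; ring

theorem integral_abs_legendreP_rpow_le {n : ℕ} (hn : 1 ≤ n) {p : ℝ} (hp : 0 ≤ p) (hp4 : p < 4) :
    ∫ x in (-1 : ℝ)..1, |(legendreP n).eval x| ^ p ≤
      2 / (1 - p / 4) * (2 / n) ^ (p / 2) := by
  have hcont : Continuous fun x : ℝ => |(legendreP n).eval x| ^ p :=
    (legendreP n).continuous.abs.rpow_const fun x => Or.inr hp
  have hint : IntervalIntegrable (fun x : ℝ => (1 - x) ^ (-(p / 4))) volume 0 1 := by
    simpa using
      (intervalIntegral.intervalIntegrable_rpow' (a := 1) (b := 0) (r := -(p / 4))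
        (by linarith)).comp_sub_left 1
  have hval : ∫ x in (0 : ℝ)..1, (1 - x) ^ (-(p / 4)) = 1 / (1 - p / 4) := by
    rw [intervalIntegral.integral_comp_sub_left (fun x : ℝ => x ^ (-(p / 4))), sub_self, sub_zero,
      integral_rpow (Or.inl (by linarith)), Real.one_rpow, Real.zero_rpow (by linarith), sub_zero,
      neg_add_eq_sub]
  calc ∫ x in (-1 : ℝ)..1, |(legendreP n).eval x| ^ p
      = 2 * ∫ x in (0 : ℝ)..1, |(legendreP n).eval x| ^ p :=
        integral_eq_two_mul_integral_of_even (hcont.intervalIntegrable _ _)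
          fun x => by rw [abs_legendreP_eval_neg]
    _ ≤ 2 * ∫ x in (0 : ℝ)..1, (2 / n) ^ (p / 2) * (1 - x) ^ (-(p / 4)) := by
        gcongr
        exact intervalIntegral.integral_mono_on_of_le_Ioo zero_le_one
          (hcont.intervalIntegrable _ _) (hint.const_mul _)
          fun x hx => abs_legendreP_rpow_le hn hp hx.1.le hx.2
    _ = 2 / (1 - p / 4) * (2 / n) ^ (p / 2) := by
        rw [intervalIntegral.integral_const_mul, hval]; ring

end PowerNorms

section CubicIntegral

theorem integral_le_of_le_rpow {f : ℝ → ℝ} {A B a b d : ℝ} (ha : -1 < a) (hb : b < -1)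
    (hB : 0 ≤ B) (hd0 : 0 < d) (hd1 : d ≤ 1) (hf : IntervalIntegrable f volume 0 1)
    (hfa : ∀ x ∈ Set.Ioo 0 d, f x ≤ A * x ^ a) (hfb : ∀ x ∈ Set.Ioo d 1, f x ≤ B * x ^ b) :
    ∫ x in (0 : ℝ)..1, f x ≤ A * d ^ (a + 1) / (a + 1) + B * d ^ (b + 1) / (-(b + 1)) := by
  have hd : d ∈ Set.uIcc 0 1 := Set.mem_uIcc_of_le hd0.le hd1
  have hf₁ : IntervalIntegrable f volume 0 d :=
    hf.mono_set (Set.uIcc_subset_uIcc_left hd)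
  have hf₂ : IntervalIntegrable f volume d 1 :=
    hf.mono_set (Set.uIcc_subset_uIcc_right hd)
  have h0 : (0 : ℝ) ∉ Set.uIcc d 1 := by
    rw [Set.uIcc_of_le hd1]
    exact fun h => hd0.not_ge h.1
  rw [← intervalIntegral.integral_add_adjacent_intervals hf₁ hf₂]
  refine add_le_add ?_ ?_
  · calc ∫ x in (0 : ℝ)..d, f x ≤ ∫ x in (0 : ℝ)..d, A * x ^ a :=
          intervalIntegral.integral_mono_on_of_le_Ioo hd0.le hf₁
            ((intervalIntegral.intervalIntegrable_rpow' ha).const_mul _) hfa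
      _ = A * d ^ (a + 1) / (a + 1) := by
          rw [intervalIntegral.integral_const_mul, integral_rpow (Or.inl ha),
            Real.zero_rpow (by linarith), sub_zero, mul_div_assoc]
  · calc ∫ x in d..(1 : ℝ), f x ≤ ∫ x in d..(1 : ℝ), B * x ^ b :=
          intervalIntegral.integral_mono_on_of_le_Ioo hd1 hf₂
            ((intervalIntegral.intervalIntegrable_rpow (Or.inr h0)).const_mul _) hfb
      _ = B * (d ^ (b + 1) - 1) / (-(b + 1)) := by
          rw [intervalIntegral.integral_const_mul, integral_rpow (Or.inr ⟨hb.ne, h0⟩),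
            Real.one_rpow, div_neg, ← neg_div, mul_div_assoc']
          ring
      _ ≤ B * d ^ (b + 1) / (-(b + 1)) := by
          gcongr
          · linarith
          · linarith

theorem mul_pow_three_le_of_rpow_mul_le {s t a B γ : ℝ} (ht : 0 < t) (hts : t ≤ s) (ha : 0 ≤ a)
    (hγ : 1 / 3 ≤ γ) (h : s ^ γ * a ≤ B) : s * a ^ 3 ≤ B ^ 3 * t ^ (1 - 3 * γ) := by
  have hs := ht.trans_le hts
  have hB : 0 ≤ B := le_trans (by positivity) h
  calc s * a ^ 3 = (s ^ γ * a) ^ 3 * s ^ (1 - 3 * γ) := by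
        have hsplit : (s ^ γ) ^ 3 * s ^ (1 - 3 * γ) = s := by
          rw [← Real.rpow_mul_natCast hs.le, ← Real.rpow_add hs]
          norm_num [mul_comm]
        linear_combination (-a ^ 3) * hsplit
    _ ≤ B ^ 3 * t ^ (1 - 3 * γ) := by
        exact mul_le_mul (by gcongr) (Real.rpow_le_rpow_of_nonpos ht hts (by linarith))
          (by positivity) (by positivity)

theorem one_sub_sq_mul_abs_derivative_legendreP_cube_le {n : ℕ} (hn : 1 ≤ n) {x : ℝ}
    (hx0 : 0 ≤ x) (hx1 : x < 1) :
    (1 - x ^ 2) * |(derivative (legendreP n)).eval x| ^ 3 ≤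
      (2 * n) ^ 3 * (1 - x) ^ (-(1 / 2) : ℝ) := by
  have hn' : (1 : ℝ) ≤ n := by exact_mod_cast hn
  have h : (1 - x ^ 2) ^ (1 / 2 : ℝ) * |(derivative (legendreP n)).eval x| ≤ 2 * n := by
    refine le_of_pow_le_pow_left₀ two_ne_zero (by positivity) ?_
    rw [mul_pow, ← Real.sqrt_eq_rpow, Real.sq_sqrt (one_sub_sq_pos hx0 hx1).le, sq_abs]
    exact (one_sub_sq_mul_derivative_legendreP_sq_le n hx0 hx1.le).trans (by nlinarith)
  convert mul_pow_three_le_of_rpow_mul_le (t := 1 - x) (by linarith) (by nlinarith)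
    (abs_nonneg _) (by norm_num) h using 3
  norm_num

theorem one_sub_sq_mul_abs_derivative_legendreP_cube_le_of_one_le {n : ℕ} (hn : 1 ≤ n) {x : ℝ}
    (hx0 : 0 ≤ x) (hx1 : x < 1) (hx : 1 ≤ n ^ 2 * (1 - x)) :
    (1 - x ^ 2) * |(derivative (legendreP n)).eval x| ^ 3 ≤
      (4 * √n) ^ 3 * (1 - x) ^ (-(5 / 4) : ℝ) := by
  have hs := one_sub_sq_pos hx0 hx1
  have hxs : 1 - x ≤ 1 - x ^ 2 := by nlinarith
  have h : (1 - x ^ 2) ^ (3 / 4 : ℝ) * |(derivative (legendreP n)).eval x| ≤ 4 * √n := by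
    refine le_of_pow_le_pow_left₀ two_ne_zero (by positivity) ?_
    have hpow : ((1 - x ^ 2) ^ (3 / 4 : ℝ)) ^ 2 = √(1 - x ^ 2) * (1 - x ^ 2) := by
      rw [← Real.rpow_mul_natCast hs.le, Real.sqrt_eq_rpow, ← Real.rpow_add_one hs.ne']
      norm_num
    rw [mul_pow, mul_pow, sq_abs, hpow, Real.sq_sqrt n.cast_nonneg]
    have hx' : 1 ≤ (n : ℝ) ^ 2 * (1 - x ^ 2) := hx.trans (by gcongr)
    linarith [sqrt_one_sub_sq_mul_derivative_legendreP_sq_le hn hx0 hx1 hx']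
  convert mul_pow_three_le_of_rpow_mul_le (t := 1 - x) (by linarith) hxs
    (abs_nonneg _) (by norm_num) h using 3
  norm_num

theorem integral_one_sub_sq_mul_abs_derivative_legendreP_cube_le {n : ℕ} (hn : 1 ≤ n) :
    ∫ x in (-1 : ℝ)..1, (1 - x ^ 2) * |(derivative (legendreP n)).eval x| ^ 3 ≤
      544 * (n : ℝ) ^ 2 := by
  have hn' : (1 : ℝ) ≤ n := by exact_mod_cast hn
  set f : ℝ → ℝ := fun x => (1 - x ^ 2) * |(derivative (legendreP n)).eval x| ^ 3 with hf
  have hfcont : Continuous f := by fun_prop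
  -- The two pointwise bounds are of the same size at `1 - x = n⁻²`.
  set d : ℝ := ((n : ℝ) ^ 2)⁻¹
  have hd0 : 0 < d := by positivity
  have hd1 : d ≤ 1 := inv_le_one_of_one_le₀ (one_le_pow₀ hn')
  have hhalf : d ^ (-(1 / 2) + 1 : ℝ) = (n : ℝ)⁻¹ := by
    norm_num [d, ← Real.sqrt_eq_rpow]
  have hquarter : d ^ (-(5 / 4) + 1 : ℝ) = √n := by
    rw [Real.inv_rpow (by positivity), ← Real.rpow_neg (by positivity),
      ← Real.rpow_natCast_mul (by positivity), Real.sqrt_eq_rpow]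
    norm_num
  have hbound : ∫ u in (0 : ℝ)..1, f (1 - u) ≤
      (2 * n) ^ 3 * d ^ (-(1 / 2) + 1 : ℝ) / (-(1 / 2) + 1) +
        (4 * √n) ^ 3 * d ^ (-(5 / 4) + 1 : ℝ) / (-(-(5 / 4) + 1)) := by
    refine integral_le_of_le_rpow (by norm_num) (by norm_num) (by positivity) hd0 hd1
      (Continuous.intervalIntegrable (by fun_prop) _ _) (fun u hu => ?_) fun u hu => ?_
    · simpa only [sub_sub_cancel] using one_sub_sq_mul_abs_derivative_legendreP_cube_le hn
        (x := 1 - u) (by linarith [hu.2]) (by linarith [hu.1])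
    · have hnu : 1 ≤ (n : ℝ) ^ 2 * u := (inv_le_iff_one_le_mul₀' (by positivity)).mp hu.1.le
      simpa only [sub_sub_cancel] using
        one_sub_sq_mul_abs_derivative_legendreP_cube_le_of_one_le hn (x := 1 - u)
          (by linarith [hu.2]) (by linarith [hu.1]) (by rwa [sub_sub_cancel])
  calc ∫ x in (-1 : ℝ)..1, f x = 2 * ∫ x in (0 : ℝ)..1, f x :=
        integral_eq_two_mul_integral_of_even (hfcont.intervalIntegrable _ _)
          fun x => by simp only [hf, abs_derivative_legendreP_eval_neg, neg_sq]
    _ = 2 * ∫ u in (0 : ℝ)..1, f (1 - u) := by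
        simp [intervalIntegral.integral_comp_sub_left]
    _ ≤ 2 * ((2 * n) ^ 3 * (n : ℝ)⁻¹ / (-(1 / 2) + 1) +
          (4 * √n) ^ 3 * √n / (-(-(5 / 4) + 1))) := by
        rw [hhalf, hquarter] at hbound
        gcongr
    _ = 544 * (n : ℝ) ^ 2 := by
        have hsqrt : √(n : ℝ) ^ 4 = n ^ 2 := by
          rw [pow_mul (√(n : ℝ)) 2 2, Real.sq_sqrt n.cast_nonneg]
        field_simp
        norm_num
        linear_combination -512 * hsqrt

theorem integral_legendreP_cube_eq (n : ℕ) :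
    3 * ((n : ℝ) * (n + 1)) ^ 2 * ∫ x in (-1 : ℝ)..1, (legendreP n).eval x ^ 3 =
      4 * ∫ x in (-1 : ℝ)..1, x * ((1 - x ^ 2) * (derivative (legendreP n)).eval x ^ 3) := by
  set P := legendreP n
  set c : ℝ[X] := (n : ℝ[X]) * ((n : ℝ[X]) + 1)
  -- The boundary terms of integrating `c² P³` by parts twice via the Legendre equation.
  set A : ℝ[X] := 3 * c * (P ^ 2 * ((1 - X ^ 2) * derivative P)) +
    2 * ((1 - X ^ 2) ^ 2 * derivative P ^ 3) with hA
  have hderiv : derivative A =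
      4 * (X * ((1 - X ^ 2) * derivative P ^ 3)) - 3 * c ^ 2 * P ^ 3 := by
    simp only [hA, c, derivative_mul, derivative_sub, derivative_one, derivative_add,
      derivative_pow, derivative_natCast, derivative_X, derivative_ofNat]
    simp only [Nat.cast_ofNat, map_ofNat, Nat.add_one_sub_one, pow_one]
    linear_combination (3 * c * P ^ 2 + 6 * (1 - X ^ 2) * derivative P ^ 2) * legendreP_ode n
  have h := integral_eval_derivative A (-1) 1
  have hbdry : A.eval 1 - A.eval (-1) = 0 := by simp [hA]
  rw [hderiv, hbdry] at h
  simp only [c, eval_sub, eval_mul, eval_pow, eval_add, eval_X, eval_one, eval_natCast,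
    eval_ofNat] at h
  rw [intervalIntegral.integral_sub (Continuous.intervalIntegrable (by fun_prop) _ _)
    (Continuous.intervalIntegrable (by fun_prop) _ _), intervalIntegral.integral_const_mul,
    intervalIntegral.integral_const_mul] at h
  linarith

theorem abs_integral_legendreP_cube_le {n : ℕ} (hn : 1 ≤ n) :
    |∫ x in (-1 : ℝ)..1, (legendreP n).eval x ^ 3| ≤ 800 / n ^ 2 := by
  set J := ∫ x in (-1 : ℝ)..1, x * ((1 - x ^ 2) * (derivative (legendreP n)).eval x ^ 3)
  have hJ : |J| ≤ 544 * (n : ℝ) ^ 2 := by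
    refine le_trans ?_ (integral_one_sub_sq_mul_abs_derivative_legendreP_cube_le hn)
    rw [← Real.norm_eq_abs]
    refine intervalIntegral.norm_integral_le_of_norm_le (by norm_num)
      (Filter.Eventually.of_forall fun x hx => ?_) (Continuous.intervalIntegrable (by fun_prop) _ _)
    have hs : 0 ≤ 1 - x ^ 2 := by nlinarith [hx.1, hx.2]
    rw [Real.norm_eq_abs, abs_mul, abs_mul, abs_pow, abs_of_nonneg hs]
    exact mul_le_of_le_one_left (by positivity) (abs_le.mpr ⟨hx.1.le, hx.2⟩)
  have hIJ := congrArg abs (integral_legendreP_cube_eq n)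
  rw [abs_mul, abs_of_pos (by positivity : 0 < 3 * ((n : ℝ) * (n + 1)) ^ 2), abs_mul 4,
    abs_of_pos (four_pos : (0 : ℝ) < 4)] at hIJ
  set I := ∫ x in (-1 : ℝ)..1, (legendreP n).eval x ^ 3
  rw [le_div_iff₀ (by positivity)]
  refine le_of_mul_le_mul_left ?_ (show 0 < 3 * (n : ℝ) ^ 2 by positivity)
  calc 3 * (n : ℝ) ^ 2 * (|I| * n ^ 2) = 3 * ((n : ℝ) * n) ^ 2 * |I| := by ring
    _ ≤ 3 * ((n : ℝ) * (n + 1)) ^ 2 * |I| := by gcongr; linarith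
    _ = 4 * |J| := hIJ
    _ ≤ 3 * (n : ℝ) ^ 2 * 800 := by nlinarith

end CubicIntegral

section PolarCoordinates

variable {E : Type*} [NormedAddCommGroup E] [NormedSpace ℝ E] [FiniteDimensional ℝ E]
  [Nontrivial E] [MeasurableSpace E] [BorelSpace E]

theorem integral_Ioi_pow_mul_exp_neg_sq (k : ℕ) :
    ∫ r in Set.Ioi (0 : ℝ), r ^ k * Real.exp (-r ^ 2) = Real.Gamma ((k + 1) / 2) / 2 := by
  have h := integral_rpow_mul_exp_neg_rpow (p := 2) (q := k) two_pos
    (neg_one_lt_zero.trans_le k.cast_nonneg)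
  simp only [Real.rpow_natCast, Real.rpow_ofNat] at h
  rw [h]
  ring

theorem integral_volumeIoiPow (k : ℕ) (g : ℝ → ℝ) :
    ∫ r : Set.Ioi (0 : ℝ), g r ∂Measure.volumeIoiPow k =
      ∫ r in Set.Ioi (0 : ℝ), r ^ k * g r := by
  simp only [Measure.volumeIoiPow, ENNReal.ofReal]
  rw [integral_withDensity_eq_integral_smul (measurable_subtype_coe.pow_const _).real_toNNReal,
    integral_subtype_comap measurableSet_Ioi fun a : ℝ => Real.toNNReal (a ^ k) • g a]
  refine setIntegral_congr_fun measurableSet_Ioi fun r hr => ?_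
  rw [NNReal.smul_def, Real.coe_toNNReal _ (pow_nonneg hr.out.le _), smul_eq_mul]

theorem integral_comp_normalize_mul_comp_norm (μ : Measure E) [μ.IsAddHaarMeasure]
    (f : E → ℝ) (g : ℝ → ℝ) :
    ∫ x, f (‖x‖⁻¹ • x) * g ‖x‖ ∂μ = (∫ y : Metric.sphere (0 : E) 1, f y ∂μ.toSphere) *
      ∫ r in Set.Ioi (0 : ℝ), r ^ (Module.finrank ℝ E - 1) * g r := by
  calc ∫ x, f (‖x‖⁻¹ • x) * g ‖x‖ ∂μ
      = ∫ x : ({(0)}ᶜ : Set E), f (‖x.1‖⁻¹ • x.1) * g ‖x.1‖ ∂μ.comap Subtype.val := by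
        rw [integral_subtype_comap (measurableSet_singleton _).compl
          fun x => f (‖x‖⁻¹ • x) * g ‖x‖, restrict_compl_singleton]
    _ = ∫ z : Metric.sphere (0 : E) 1 × Set.Ioi (0 : ℝ), f z.1 * g z.2
          ∂μ.toSphere.prod (.volumeIoiPow (Module.finrank ℝ E - 1)) := by
        simpa using μ.measurePreserving_homeomorphUnitSphereProd.integral_comp
          (Homeomorph.measurableEmbedding _)
          fun z : Metric.sphere (0 : E) 1 × Set.Ioi (0 : ℝ) => f z.1 * g z.2
    _ = _ := by
        rw [integral_prod_mul (fun y : Metric.sphere (0 : E) 1 => f y)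
          fun r : Set.Ioi (0 : ℝ) => g r, integral_volumeIoiPow]

theorem integral_toSphere_comp_linearIsometryEquiv {μ : Measure E} [μ.IsAddHaarMeasure]
    {U : E ≃ₗᵢ[ℝ] E} (hU : MeasurePreserving U μ μ) (f : E → ℝ) :
    ∫ y : Metric.sphere (0 : E) 1, f (U y) ∂μ.toSphere =
      ∫ y : Metric.sphere (0 : E) 1, f y ∂μ.toSphere := by
  set g : ℝ → ℝ := fun r => Real.exp (-r ^ 2)
  have hg : ∫ r in Set.Ioi (0 : ℝ), r ^ (Module.finrank ℝ E - 1) * g r ≠ 0 := by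
    rw [integral_Ioi_pow_mul_exp_neg_sq]
    exact (half_pos (Real.Gamma_pos_of_pos (by positivity))).ne'
  refine mul_right_cancel₀ hg ?_
  rw [← integral_comp_normalize_mul_comp_norm μ (fun y => f (U y)),
    ← integral_comp_normalize_mul_comp_norm,
    ← hU.integral_comp U.toHomeomorph.measurableEmbedding fun x => f (‖x‖⁻¹ • x) * g ‖x‖]
  simp only [map_smul, U.norm_map]

end PolarCoordinates

section SphereMoments

theorem integral_sigmaS2_comp_linearIsometryEquiv
    (U : EuclideanSpace ℝ (Fin 3) ≃ₗᵢ[ℝ] EuclideanSpace ℝ (Fin 3))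
    (f : EuclideanSpace ℝ (Fin 3) → ℝ) :
    ∫ y : S2, f (U y) ∂sigmaS2 = ∫ y : S2, f y ∂sigmaS2 :=
  integral_toSphere_comp_linearIsometryEquiv U.measurePreserving f

theorem integral_pow_mul_exp_neg_sq_of_even {i : ℕ} (hi : Even i) :
    ∫ t : ℝ, t ^ i * Real.exp (-t ^ 2) = Real.Gamma ((i + 1) / 2) := by
  have h := integral_comp_abs (f := fun t : ℝ => t ^ i * Real.exp (-t ^ 2))
  simp only [hi.pow_abs, sq_abs] at h
  rw [h, integral_Ioi_pow_mul_exp_neg_sq]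
  ring

theorem integral_coord_zero_pow_mul_exp_neg_norm_sq {i : ℕ} (hi : Even i) :
    ∫ x : EuclideanSpace ℝ (Fin 3), x 0 ^ i * Real.exp (-‖x‖ ^ 2) =
      Real.Gamma ((i + 1) / 2) * Real.pi := by
  have hgauss : ∫ t : ℝ, Real.exp (-t ^ 2) = √Real.pi := by
    simpa using integral_gaussian 1
  rw [← (PiLp.volume_preserving_toLp (Fin 3)).integral_comp
    (MeasurableEquiv.toLp 2 _).measurableEmbedding]
  have h := integral_fintype_prod_volume_eq_prod
    ![fun t : ℝ => t ^ i * Real.exp (-t ^ 2), fun t => Real.exp (-t ^ 2),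
      fun t => Real.exp (-t ^ 2)]
  simp only [Fin.prod_univ_three, Matrix.cons_val, hgauss, integral_pow_mul_exp_neg_sq_of_even hi,
    mul_assoc, Real.mul_self_sqrt Real.pi_pos.le] at h
  rw [← h]
  simp only [EuclideanSpace.real_norm_sq_eq, Fin.sum_univ_three, neg_add, Real.exp_add, mul_assoc]

theorem integral_coord_zero_pow (i : ℕ) :
    ∫ y : S2, (y : EuclideanSpace ℝ (Fin 3)) 0 ^ i ∂sigmaS2 =
      2 * Real.pi * ∫ t in (-1 : ℝ)..1, t ^ i := by
  rcases i.even_or_odd with hi | hi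
  · have hG : Real.Gamma ((i + 1) / 2) ≠ 0 := (Real.Gamma_pos_of_pos (by positivity)).ne'
    have h := integral_comp_normalize_mul_comp_norm
      (volume : Measure (EuclideanSpace ℝ (Fin 3))) (fun x => x 0 ^ i)
      fun r => r ^ i * Real.exp (-r ^ 2)
    have hhom (x : EuclideanSpace ℝ (Fin 3)) :
        (‖x‖⁻¹ • x) 0 ^ i * (‖x‖ ^ i * Real.exp (-‖x‖ ^ 2)) = x 0 ^ i * Real.exp (-‖x‖ ^ 2) := by
      rcases eq_or_ne x 0 with rfl | hx
      · rcases eq_or_ne i 0 with rfl | hi0 <;> simp [*]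
      · rw [← mul_assoc, ← mul_pow, PiLp.smul_apply, smul_eq_mul, mul_comm ‖x‖⁻¹, mul_assoc,
          inv_mul_cancel₀ (norm_ne_zero_iff.mpr hx), mul_one]
    simp only [hhom, integral_coord_zero_pow_mul_exp_neg_norm_sq hi, finrank_euclideanSpace_fin,
      ← mul_assoc, ← pow_add] at h
    rw [integral_Ioi_pow_mul_exp_neg_sq,
      show (((3 - 1 + i : ℕ) : ℝ) + 1) / 2 = (i + 1) / 2 + 1 by push_cast; ring,
      Real.Gamma_add_one (by positivity)] at h
    rw [integral_pow, hi.add_one.neg_one_pow, sigmaS2, one_pow]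
    field_simp at h ⊢
    linear_combination -h
  · have hneg := integral_sigmaS2_comp_linearIsometryEquiv (LinearIsometryEquiv.neg ℝ)
      fun x => x 0 ^ i
    simp only [LinearIsometryEquiv.coe_neg, PiLp.neg_apply, hi.neg_pow, integral_neg] at hneg
    rw [integral_pow, hi.add_one.neg_one_pow, one_pow, sub_self, zero_div, mul_zero]
    linarith

end SphereMoments

section ZonalIntegrals

local notation "ℝ³" => EuclideanSpace ℝ (Fin 3)

theorem integrable_of_continuous_of_compactSpace {α : Type*} [TopologicalSpace α] [CompactSpace α]
    [MeasurableSpace α] [OpensMeasurableSpace α] {μ : Measure α} [IsFiniteMeasureOnCompacts μ]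
    {f : α → ℝ} (hf : Continuous f) : Integrable f μ :=
  hf.integrable_of_hasCompactSupport (.of_compactSpace f)

instance : IsFiniteMeasure sigmaS2 :=
  inferInstanceAs (IsFiniteMeasure (Measure.toSphere _))

instance : sigmaS2.IsOpenPosMeasure :=
  inferInstanceAs (Measure.toSphere _).IsOpenPosMeasure

/-- The Euclidean inner product `⟨x, y⟩ = cos d(x, y)` of two points of `S²`. -/
noncomputable def sdot (x y : S2) : ℝ :=
  inner ℝ (x : ℝ³) (y : ℝ³)

theorem sdot_comm (x y : S2) : sdot x y = sdot y x :=
  real_inner_comm _ _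

theorem sdot_self (x : S2) : sdot x x = 1 := by
  simp [sdot]

theorem abs_sdot_le_one (x y : S2) : |sdot x y| ≤ 1 := by
  simpa [sdot] using abs_real_inner_le_norm (x : ℝ³) (y : ℝ³)

@[fun_prop]
theorem continuous_sdot {α : Type*} [TopologicalSpace α] {f g : α → S2} (hf : Continuous f)
    (hg : Continuous g) : Continuous fun a => sdot (f a) (g a) := by
  unfold sdot
  fun_prop

theorem exists_linearIsometryEquiv_sdot_eq (x z : S2) :
    ∃ (U : ℝ³ ≃ₗᵢ[ℝ] ℝ³) (β : ℝ), β ^ 2 = 1 - sdot z x ^ 2 ∧ ∀ y : S2,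
      sdot z y = U y 0 ∧ sdot x y = sdot z x * U y 0 + β * U y 1 := by
  set v : Fin 3 → ℝ³ := ![z, x, 0]
  set b := InnerProductSpace.gramSchmidtOrthonormalBasis (𝕜 := ℝ) (by simp) v
  have hz : b 0 = z := by
    have hne : InnerProductSpace.gramSchmidtNormed ℝ v 0 = z := by
      have hgs : InnerProductSpace.gramSchmidt ℝ v 0 = z := InnerProductSpace.gramSchmidt_bot ℝ v
      simp [InnerProductSpace.gramSchmidtNormed, hgs]
    rw [InnerProductSpace.gramSchmidtOrthonormalBasis_apply _ (by
      rw [hne]; exact ne_zero_of_mem_unit_sphere z), hne]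
  have hx2 : inner ℝ (x : ℝ³) (b 2) = 0 := by
    rw [real_inner_comm]
    exact InnerProductSpace.gramSchmidtOrthonormalBasis_inv_triangular _ v
      (show (1 : Fin 3) < 2 by decide)
  have hexpand (y : S2) :
      sdot x y = sdot z x * b.repr y 0 + inner ℝ (x : ℝ³) (b 1) * b.repr y 1 := by
    rw [sdot, ← b.sum_inner_mul_inner, Fin.sum_univ_three, hx2, zero_mul, add_zero, hz,
      sdot_comm, sdot, b.repr_apply_apply, b.repr_apply_apply, hz]
  refine ⟨b.repr, inner ℝ (x : ℝ³) (b 1), ?_, fun y => ⟨?_, hexpand y⟩⟩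
  · have h := hexpand x
    rw [sdot_self, b.repr_apply_apply, b.repr_apply_apply, hz, ← sdot,
      real_inner_comm _ (b 1)] at h
    linarith
  · rw [b.repr_apply_apply, hz, sdot]

theorem integral_comp_sdot_sdot (F : ℝ → ℝ → ℝ) (x z : S2) :
    ∃ β : ℝ, β ^ 2 = 1 - sdot z x ^ 2 ∧
      ∫ y : S2, F (sdot z y) (sdot x y) ∂sigmaS2 =
        ∫ y : S2, F ((y : ℝ³) 0) (sdot z x * (y : ℝ³) 0 + β * (y : ℝ³) 1) ∂sigmaS2 := by
  obtain ⟨U, β, hβ, hU⟩ := exists_linearIsometryEquiv_sdot_eq x z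
  refine ⟨β, hβ, ?_⟩
  rw [← integral_sigmaS2_comp_linearIsometryEquiv U
    fun y => F (y 0) (sdot z x * y 0 + β * y 1)]
  simp only [(hU _).1, (hU _).2]

theorem integral_eval_sdot (p : ℝ[X]) (z : S2) :
    ∫ y : S2, p.eval (sdot z y) ∂sigmaS2 = 2 * Real.pi * ∫ t in (-1 : ℝ)..1, p.eval t := by
  obtain ⟨-, -, h⟩ := integral_comp_sdot_sdot (fun s _ => p.eval s) z z
  rw [h]
  simp only [eval_eq_sum_range]
  rw [integral_finsetSum _ fun i _ => integrable_of_continuous_of_compactSpace (by fun_prop),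
    intervalIntegral.integral_finsetSum fun i _ =>
      Continuous.intervalIntegrable (by fun_prop) _ _, Finset.mul_sum]
  refine Finset.sum_congr rfl fun i _ => ?_
  rw [integral_const_mul, integral_coord_zero_pow, intervalIntegral.integral_const_mul]
  ring

theorem sigmaS2_real_univ : sigmaS2.real Set.univ = 4 * Real.pi := by
  have h := integral_coord_zero_pow 0
  simp only [pow_zero, integral_const, smul_eq_mul, mul_one,
    intervalIntegral.integral_const] at h
  linarith

theorem integral_comp_sdot {f : ℝ → ℝ} (hf : Continuous f) (z : S2) :
    ∫ y : S2, f (sdot z y) ∂sigmaS2 = 2 * Real.pi * ∫ t in (-1 : ℝ)..1, f t := by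
  refine eq_of_forall_dist_le fun ε hε => ?_
  obtain ⟨p, hp⟩ := exists_polynomial_near_of_continuousOn (-1) 1 f hf.continuousOn
    (ε / (8 * Real.pi)) (by positivity)
  have hsphere : |∫ y : S2, (f (sdot z y) - p.eval (sdot z y)) ∂sigmaS2| ≤ ε / 2 := by
    rw [← Real.norm_eq_abs]
    refine (norm_integral_le_of_norm_le_const (C := ε / (8 * Real.pi))
      (Filter.Eventually.of_forall fun y => ?_)).trans_eq ?_
    · rw [Real.norm_eq_abs, abs_sub_comm]
      exact (hp _ (abs_le.mp (abs_sdot_le_one z y))).le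
    · rw [sigmaS2_real_univ]
      field_simp
      norm_num
  have hinterval : |∫ t in (-1 : ℝ)..1, (p.eval t - f t)| ≤ ε / (4 * Real.pi) := by
    rw [← Real.norm_eq_abs]
    refine (intervalIntegral.norm_integral_le_of_norm_le_const (C := ε / (8 * Real.pi))
      fun t ht => ?_).trans_eq ?_
    · rw [Set.uIoc_of_le (by norm_num)] at ht
      exact (hp t ⟨ht.1.le, ht.2⟩).le
    · norm_num
      field_simp
      norm_num
  rw [integral_sub (integrable_of_continuous_of_compactSpace (by fun_prop))
    (integrable_of_continuous_of_compactSpace (by fun_prop)), integral_eval_sdot] at hsphere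
  rw [intervalIntegral.integral_sub (p.continuous.intervalIntegrable _ _)
    (hf.intervalIntegrable _ _)] at hinterval
  have hscaled := mul_le_mul_of_nonneg_left hinterval Real.two_pi_pos.le
  rw [← abs_of_pos Real.two_pi_pos, ← abs_mul, abs_of_pos Real.two_pi_pos, mul_sub,
    show 2 * Real.pi * (ε / (4 * Real.pi)) = ε / 2 by field_simp; norm_num] at hscaled
  rw [Real.dist_eq]
  exact (abs_sub_le _ _ _).trans ((add_le_add hsphere hscaled).trans_eq (add_halves ε))

theorem integral_mul_coord_one_pow_eq_zero_of_odd (f : ℝ → ℝ) {j : ℕ} (hj : Odd j) :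
    ∫ y : S2, f ((y : ℝ³) 0) * (y : ℝ³) 1 ^ j ∂sigmaS2 = 0 := by
  have h := integral_sigmaS2_comp_linearIsometryEquiv
    (LinearIsometryEquiv.piLpCongrRight 2
      ![.refl ℝ ℝ, LinearIsometryEquiv.neg ℝ, .refl ℝ ℝ])
    fun y => f (y 0) * y 1 ^ j
  simp only [LinearIsometryEquiv.piLpCongrRight_apply, Matrix.cons_val, hj.neg_pow, mul_neg,
    integral_neg, LinearIsometryEquiv.coe_neg, LinearIsometryEquiv.coe_refl, id] at h
  linarith

theorem exists_eval_sdot_eq_integral_mul_sdot_pow (p : ℝ[X]) (k : ℕ) :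
    ∃ g : ℝ[X], g.natDegree ≤ k ∧ ∀ x z : S2,
      ∫ y : S2, p.eval (sdot z y) * sdot x y ^ k ∂sigmaS2 = g.eval (sdot z x) := by
  set moment : ℕ → ℝ := fun j =>
    ∫ y : S2, p.eval ((y : ℝ³) 0) * (y : ℝ³) 0 ^ (k - j) * (y : ℝ³) 1 ^ j ∂sigmaS2
  have hodd {j : ℕ} (hj : Odd j) : moment j = 0 :=
    integral_mul_coord_one_pow_eq_zero_of_odd (fun s => p.eval s * s ^ (k - j)) hj
  refine ⟨∑ j ∈ Finset.range (k + 1),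
    C (k.choose j * moment j) * (X ^ (k - j) * (1 - X ^ 2) ^ (j / 2)), ?_, fun x z => ?_⟩
  · refine natDegree_sum_le_of_forall_le _ _ fun j hj => (natDegree_C_mul_le _ _).trans ?_
    have hpow : ((1 - X ^ 2 : ℝ[X]) ^ (j / 2)).natDegree ≤ j / 2 * 2 :=
      natDegree_pow_le_of_le _ (by compute_degree)
    have hjk := Finset.mem_range_succ_iff.mp hj
    refine natDegree_mul_le.trans ?_
    rw [natDegree_X_pow]
    lia
  obtain ⟨β, hβ, hint⟩ := integral_comp_sdot_sdot (fun s t => p.eval s * t ^ k) x z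
  have hbinom (y : S2) : p.eval ((y : ℝ³) 0) * (sdot z x * (y : ℝ³) 0 + β * (y : ℝ³) 1) ^ k =
      ∑ j ∈ Finset.range (k + 1), k.choose j * (sdot z x ^ (k - j) * β ^ j) *
        (p.eval ((y : ℝ³) 0) * (y : ℝ³) 0 ^ (k - j) * (y : ℝ³) 1 ^ j) := by
    rw [add_comm, add_pow, Finset.mul_sum]
    exact Finset.sum_congr rfl fun j _ => by ring
  rw [hint]
  simp only [hbinom]
  rw [integral_finsetSum _ fun j _ => integrable_of_continuous_of_compactSpace (by fun_prop),
    eval_finsetSum]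
  refine Finset.sum_congr rfl fun j _ => ?_
  rw [integral_const_mul]
  simp only [eval_mul, eval_C, eval_pow, eval_X, eval_sub, eval_one, ← hβ]
  change _ * moment j = _
  rcases j.even_or_odd with hj | hj
  · rw [← pow_mul, Nat.two_mul_div_two_of_even hj]
    ring
  · rw [hodd hj, mul_zero, mul_zero, zero_mul]

theorem exists_eval_sdot_eq_integral (p q : ℝ[X]) :
    ∃ g : ℝ[X], g.natDegree ≤ q.natDegree ∧ ∀ x z : S2,
      ∫ y : S2, p.eval (sdot z y) * q.eval (sdot x y) ∂sigmaS2 = g.eval (sdot z x) := by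
  choose g hdeg hg using exists_eval_sdot_eq_integral_mul_sdot_pow p
  refine ⟨∑ k ∈ Finset.range (q.natDegree + 1), C (q.coeff k) * g k, ?_, fun x z => ?_⟩
  · exact natDegree_sum_le_of_forall_le _ _ fun k hk => (natDegree_C_mul_le _ _).trans
      ((hdeg k).trans (Finset.mem_range_succ_iff.mp hk))
  · simp only [eval_eq_sum_range (p := q), Finset.mul_sum, mul_left_comm _ (q.coeff _)]
    rw [integral_finsetSum _ fun k _ => integrable_of_continuous_of_compactSpace (by fun_prop)]
    simp only [integral_const_mul, hg, eval_finsetSum, eval_C_mul]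

theorem integral_sdot_swap {f g h : ℝ → ℝ} (hf : Continuous f) (hg : Continuous g)
    (hh : Continuous h) (z : S2) :
    ∫ x : S2, (∫ y : S2, f (sdot z y) * g (sdot x y) ∂sigmaS2) * h (sdot z x) ∂sigmaS2 =
      ∫ y : S2, f (sdot z y) * ∫ x : S2, h (sdot z x) * g (sdot y x) ∂sigmaS2 ∂sigmaS2 := by
  simp only [← integral_mul_const, ← integral_const_mul]
  rw [integral_integral_swap]
  · refine integral_congr_ae (.of_forall fun y => integral_congr_ae (.of_forall fun x => ?_))
    simp only [sdot_comm x y]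
    ring
  · exact integrable_of_continuous_of_compactSpace (by unfold Function.uncurry; fun_prop)

theorem integral_eval_sdot_mul_legendreP_eq_zero {n : ℕ} {q : ℝ[X]} (hq : q.natDegree < n)
    (x z : S2) :
    ∫ y : S2, q.eval (sdot x y) * (legendreP n).eval (sdot z y) ∂sigmaS2 = 0 := by
  obtain ⟨g, -, hg⟩ := exists_eval_sdot_eq_integral (legendreP n) q
  obtain ⟨h, hhdeg, hh⟩ := exists_eval_sdot_eq_integral g q
  -- Swapping the integrals turns `∫ g²` into `∫ P_n h` with `deg h < n`.
  have hsq : ∫ w : S2, g.eval (sdot z w) * g.eval (sdot z w) ∂sigmaS2 = 0 :=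
    calc ∫ w : S2, g.eval (sdot z w) * g.eval (sdot z w) ∂sigmaS2
        = ∫ y : S2, (legendreP n * h).eval (sdot z y) ∂sigmaS2 := by
          simp only [eval_mul, ← hh]
          rw [← integral_sdot_swap (legendreP n).continuous q.continuous g.continuous]
          simp only [hg]
      _ = 0 := by
          rw [integral_eval_sdot]
          simp only [eval_mul, integral_legendreP_mul_eq_zero (hhdeg.trans_lt hq), mul_zero]
  simp only [mul_comm (q.eval _), hg]
  have hcont : Continuous fun w : S2 => g.eval (sdot z w) * g.eval (sdot z w) :=
    (g.continuous.comp (by fun_prop)).mul (g.continuous.comp (by fun_prop))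
  rw [integral_eq_zero_iff_of_nonneg (fun w => mul_self_nonneg _)
    (integrable_of_continuous_of_compactSpace hcont),
    hcont.ae_eq_iff_eq _ continuous_zero] at hsq
  exact mul_self_eq_zero.mp (congrFun hsq x)

theorem integral_eval_sdot_mul_legendreP (p : ℝ[X]) (n : ℕ) (x z : S2) :
    ∫ y : S2, p.eval (sdot z y) * (legendreP n).eval (sdot x y) ∂sigmaS2 =
      (2 * Real.pi * ∫ t in (-1 : ℝ)..1, p.eval t * (legendreP n).eval t) *
        (legendreP n).eval (sdot z x) := by
  obtain ⟨g, hdeg, hg⟩ := exists_eval_sdot_eq_integral p (legendreP n)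
  have horth (q : ℝ[X]) (hq : q.natDegree < n) : ∫ t in (-1 : ℝ)..1, g.eval t * q.eval t = 0 := by
    have hsphere := integral_sdot_swap p.continuous (legendreP n).continuous q.continuous z
    simp only [hg, integral_eval_sdot_mul_legendreP_eq_zero hq, mul_zero, integral_zero,
      ← eval_mul, integral_eval_sdot] at hsphere ⊢
    exact (mul_eq_zero.mp hsphere).resolve_left Real.two_pi_pos.ne'
  have hval : g.eval 1 = 2 * Real.pi * ∫ t in (-1 : ℝ)..1, p.eval t * (legendreP n).eval t := by
    have hdiag := hg z z
    rw [sdot_self] at hdiag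
    simp only [← hdiag, ← eval_mul, integral_eval_sdot]
  rw [hg, ← hval, ← eval_C_mul,
    ← eq_C_mul_legendreP_of_orthogonal (hdeg.trans (natDegree_legendreP_le n)) horth]

end ZonalIntegrals

section CycleIntegrals

/-- The integral over `S²` of the zonal function `y ↦ f ⟨x, y⟩`, which does not depend on `x`. -/
noncomputable def zonalIntegral (f : ℝ → ℝ) : ℝ :=
  2 * Real.pi * ∫ t in (-1 : ℝ)..1, f t

/-- The integral over `(S²)⁴` of a product of zonal kernels, one for each edge of the 4-cycle
`x₁ x₂ x₃ x₄`. -/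
noncomputable def cycleIntegral (f g h k : ℝ → ℝ) : ℝ :=
  ∫ x : S2 × S2 × S2 × S2, f (sdot x.1 x.2.1) * g (sdot x.2.1 x.2.2.1) *
    h (sdot x.2.2.1 x.2.2.2) * k (sdot x.1 x.2.2.2)
    ∂(sigmaS2.prod (sigmaS2.prod (sigmaS2.prod sigmaS2)))

theorem legendreKernel_eq_eval_sdot (n : ℕ) (x y : S2) :
    legendreKernel n x y = (legendreP n).eval (sdot x y) := by
  simp [legendreKernel, sphDist, InnerProductGeometry.cos_angle, sdot]

theorem contractionK_eq_cycleIntegral (n q r : ℕ) :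
    contractionK n q r = cycleIntegral (fun t => (legendreP n).eval t ^ r)
      (fun t => (legendreP n).eval t ^ (q - r)) (fun t => (legendreP n).eval t ^ r)
      (fun t => (legendreP n).eval t ^ (q - r)) := by
  simp only [contractionK, cycleIntegral, legendreKernel_eq_eval_sdot]

theorem measurePreserving_rotate {α : Type*} [MeasurableSpace α] (μ : Measure α) [SFinite μ] :
    MeasurePreserving (fun x : α × α × α × α => (x.2.1, x.2.2.1, x.2.2.2, x.1))
      (μ.prod (μ.prod (μ.prod μ))) (μ.prod (μ.prod (μ.prod μ))) :=
  ((MeasurePreserving.id μ).prod (measurePreserving_prodAssoc μ μ μ)).comp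
    ((measurePreserving_prodAssoc μ (μ.prod μ) μ).comp Measure.measurePreserving_swap)

variable {f g h k : ℝ → ℝ}

theorem cycleIntegral_rotate (hf : Continuous f) (hg : Continuous g) (hh : Continuous h)
    (hk : Continuous k) : cycleIntegral f g h k = cycleIntegral g h k f := by
  have hrot := measurePreserving_rotate sigmaS2
  rw [cycleIntegral, cycleIntegral]
  conv_rhs => rw [← hrot.map_eq]
  rw [integral_map hrot.aemeasurable (Continuous.aestronglyMeasurable (by fun_prop))]
  refine integral_congr_ae (.of_forall fun x => ?_)
  simp only [sdot_comm x.2.2.2 x.1, sdot_comm x.2.1 x.1]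
  ring

theorem contractionK_symm {n q r : ℕ} (hr : r ≤ q) :
    contractionK n q r = contractionK n q (q - r) := by
  rw [contractionK_eq_cycleIntegral, contractionK_eq_cycleIntegral, Nat.sub_sub_self hr]
  exact cycleIntegral_rotate (by fun_prop) (by fun_prop) (by fun_prop) (by fun_prop)

theorem cycleIntegral_eq_iterated (hf : Continuous f) (hg : Continuous g) (hh : Continuous h)
    (hk : Continuous k) : cycleIntegral f g h k =
      ∫ x, ∫ y, f (sdot x y) * ∫ z, g (sdot y z) * ∫ w, h (sdot z w) * k (sdot x w)
        ∂sigmaS2 ∂sigmaS2 ∂sigmaS2 ∂sigmaS2 := by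
  rw [cycleIntegral, integral_prod _ (integrable_of_continuous_of_compactSpace (by fun_prop))]
  refine integral_congr_ae (.of_forall fun x => ?_)
  simp only
  rw [integral_prod _ (integrable_of_continuous_of_compactSpace (by fun_prop))]
  refine integral_congr_ae (.of_forall fun y => ?_)
  simp only
  rw [integral_prod _ (integrable_of_continuous_of_compactSpace (by fun_prop))]
  simp only [mul_assoc, integral_const_mul]

theorem cycleIntegral_one (hf : Continuous f) (hg : Continuous g) (hh : Continuous h) :
    cycleIntegral f g h 1 =
      4 * Real.pi * (zonalIntegral f * zonalIntegral g * zonalIntegral h) := by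
  rw [cycleIntegral_eq_iterated hf hg hh continuous_one]
  simp only [Pi.one_apply, mul_one, integral_comp_sdot hh, integral_mul_const,
    integral_comp_sdot hg, integral_comp_sdot hf, integral_const, sigmaS2_real_univ,
    smul_eq_mul, zonalIntegral]
  ring

theorem cycleIntegral_legendreP_eval (n : ℕ) (p : ℝ[X]) :
    cycleIntegral (fun t => (legendreP n).eval t) (fun t => p.eval t)
      (fun t => (legendreP n).eval t) (fun t => p.eval t) =
      4 * Real.pi * (zonalIntegral (fun t => p.eval t * (legendreP n).eval t) ^ 2 *
        zonalIntegral fun t => (legendreP n).eval t ^ 2) := by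
  set c := zonalIntegral fun t => p.eval t * (legendreP n).eval t
  have hconv (y z : S2) : ∫ w, p.eval (sdot y w) * (legendreP n).eval (sdot z w) ∂sigmaS2 =
      c * (legendreP n).eval (sdot y z) :=
    integral_eval_sdot_mul_legendreP p n z y
  have hconv₂ (x y : S2) : ∫ z, p.eval (sdot y z) *
      ∫ w, (legendreP n).eval (sdot z w) * p.eval (sdot x w) ∂sigmaS2 ∂sigmaS2 =
      c ^ 2 * (legendreP n).eval (sdot x y) := by
    simp only [mul_comm ((legendreP n).eval _) (p.eval _), hconv, mul_left_comm _ c,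
      integral_const_mul]
    rw [sdot_comm x y]
    ring
  have hnorm (x : S2) : ∫ y, (legendreP n).eval (sdot x y) ^ 2 ∂sigmaS2 =
      zonalIntegral fun t => (legendreP n).eval t ^ 2 :=
    integral_comp_sdot (f := fun t => (legendreP n).eval t ^ 2) (by fun_prop) x
  rw [cycleIntegral_eq_iterated (by fun_prop) (by fun_prop) (by fun_prop) (by fun_prop)]
  simp only [hconv₂, mul_left_comm _ (c ^ 2), ← pow_two, integral_const_mul, hnorm,
    integral_const, sigmaS2_real_univ, smul_eq_mul]

theorem abs_cycleIntegral_le (f g h k : ℝ → ℝ) :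
    |cycleIntegral f g h k| ≤
      cycleIntegral (fun t => |f t|) (fun t => |g t|) (fun t => |h t|) fun t => |k t| := by
  simp only [cycleIntegral, ← abs_mul]
  exact abs_integral_le_integral_abs

theorem cycleIntegral_alternating_le (hf : Continuous f) (hg : Continuous g) (hg0 : 0 ≤ g) :
    cycleIntegral f g f g ≤
      4 * Real.pi * (zonalIntegral (f ^ 2) * zonalIntegral g ^ 2) := by
  have hrot : cycleIntegral 1 g (f ^ 2) g = cycleIntegral g (f ^ 2) g 1 :=
    cycleIntegral_rotate continuous_one hg (hf.pow 2) hg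
  have hrot' : cycleIntegral (f ^ 2) g 1 g = cycleIntegral g (f ^ 2) g 1 := by
    rw [cycleIntegral_rotate (hf.pow 2) hg continuous_one hg,
      cycleIntegral_rotate hg continuous_one hg (hf.pow 2), hrot]
  have hamgm : 2 * cycleIntegral f g f g ≤
      cycleIntegral (f ^ 2) g 1 g + cycleIntegral 1 g (f ^ 2) g := by
    simp only [cycleIntegral, Pi.pow_apply, Pi.one_apply]
    rw [← integral_add (integrable_of_continuous_of_compactSpace (by fun_prop))
      (integrable_of_continuous_of_compactSpace (by fun_prop)), ← integral_const_mul]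
    refine integral_mono (integrable_of_continuous_of_compactSpace (by fun_prop))
      (integrable_of_continuous_of_compactSpace (by fun_prop)) fun x => ?_
    have hgg := mul_nonneg (hg0 (sdot x.2.1 x.2.2.1)) (hg0 (sdot x.1 x.2.2.2))
    nlinarith [mul_nonneg hgg (sq_nonneg (f (sdot x.1 x.2.1) - f (sdot x.2.2.1 x.2.2.2)))]
  rw [hrot, hrot', cycleIntegral_one hg (hf.pow 2) hg] at hamgm
  linarith

theorem four_mul_prod_sq_le {a b c d : ℝ} (ha : 0 ≤ a) (hb : 0 ≤ b) (hc : 0 ≤ c) (hd : 0 ≤ d) :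
    4 * (a ^ 2 * b ^ 2 * c ^ 2 * d ^ 2) ≤ a ^ 3 * b ^ 3 * c ^ 2 + b ^ 3 * c ^ 3 * d ^ 2 +
      (c ^ 3 * d ^ 3 * a ^ 2 + d ^ 3 * a ^ 3 * b ^ 2) := by
  obtain ⟨x, hx, rfl⟩ : ∃ x, 0 ≤ x ∧ x ^ 2 = a := ⟨√a, Real.sqrt_nonneg a, Real.sq_sqrt ha⟩
  obtain ⟨y, hy, rfl⟩ : ∃ y, 0 ≤ y ∧ y ^ 2 = b := ⟨√b, Real.sqrt_nonneg b, Real.sq_sqrt hb⟩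
  obtain ⟨z, hz, rfl⟩ : ∃ z, 0 ≤ z ∧ z ^ 2 = c := ⟨√c, Real.sqrt_nonneg c, Real.sq_sqrt hc⟩
  obtain ⟨w, hw, rfl⟩ : ∃ w, 0 ≤ w ∧ w ^ 2 = d := ⟨√d, Real.sqrt_nonneg d, Real.sq_sqrt hd⟩
  have hprod : 0 ≤ (x * y * z * w) ^ 3 := by positivity
  linarith [sq_nonneg (x ^ 3 * y ^ 3 * z ^ 2 - z ^ 3 * w ^ 3 * x ^ 2),
    sq_nonneg (y ^ 3 * z ^ 3 * w ^ 2 - w ^ 3 * x ^ 3 * y ^ 2),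
    mul_nonneg hprod (sq_nonneg (x * z - y * w))]

theorem cycleIntegral_sq_le (hf : Continuous f) (hf0 : 0 ≤ f) :
    cycleIntegral (f ^ 2) (f ^ 2) (f ^ 2) (f ^ 2) ≤
      4 * Real.pi * (zonalIntegral (f ^ 3) ^ 2 * zonalIntegral (f ^ 2)) := by
  have h2 := hf.pow 2
  have h3 := hf.pow 3
  have hrot₁ : cycleIntegral 1 (f ^ 3) (f ^ 3) (f ^ 2) = cycleIntegral (f ^ 3) (f ^ 3) (f ^ 2) 1 :=
    cycleIntegral_rotate continuous_one h3 h3 h2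
  have hrot₂ : cycleIntegral (f ^ 2) 1 (f ^ 3) (f ^ 3) = cycleIntegral 1 (f ^ 3) (f ^ 3) (f ^ 2) :=
    cycleIntegral_rotate h2 continuous_one h3 h3
  have hrot₃ : cycleIntegral (f ^ 3) (f ^ 2) 1 (f ^ 3) = cycleIntegral (f ^ 2) 1 (f ^ 3) (f ^ 3) :=
    cycleIntegral_rotate h3 h2 continuous_one h3
  have hamgm : 4 * cycleIntegral (f ^ 2) (f ^ 2) (f ^ 2) (f ^ 2) ≤
      cycleIntegral (f ^ 3) (f ^ 3) (f ^ 2) 1 + cycleIntegral 1 (f ^ 3) (f ^ 3) (f ^ 2) +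
        (cycleIntegral (f ^ 2) 1 (f ^ 3) (f ^ 3) + cycleIntegral (f ^ 3) (f ^ 2) 1 (f ^ 3)) := by
    simp only [cycleIntegral, Pi.pow_apply, Pi.one_apply]
    rw [← integral_const_mul]
    repeat rw [← integral_add (integrable_of_continuous_of_compactSpace (by fun_prop))
      (integrable_of_continuous_of_compactSpace (by fun_prop))]
    refine integral_mono (integrable_of_continuous_of_compactSpace (by fun_prop))
      (integrable_of_continuous_of_compactSpace (by fun_prop)) fun x => ?_
    refine (four_mul_prod_sq_le (hf0 (sdot x.1 x.2.1)) (hf0 (sdot x.2.1 x.2.2.1))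
      (hf0 (sdot x.2.2.1 x.2.2.2)) (hf0 (sdot x.1 x.2.2.2))).trans_eq ?_
    ring
  rw [hrot₃, hrot₂, hrot₁, cycleIntegral_one h3 h3 h2] at hamgm
  linarith

end CycleIntegrals

section ContractionBounds

/-- The moment `∫ |P_n(cos d(x, y))|^m dy` over `S²`, which does not depend on `x`. -/
noncomputable def legendreMoment (n m : ℕ) : ℝ :=
  zonalIntegral fun t => |(legendreP n).eval t| ^ m

theorem legendreMoment_nonneg (n m : ℕ) : 0 ≤ legendreMoment n m :=
  mul_nonneg (by positivity)
    (intervalIntegral.integral_nonneg (by norm_num) fun _ _ => by positivity)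

theorem legendreMoment_two (n : ℕ) :
    legendreMoment n 2 = zonalIntegral fun t => (legendreP n).eval t ^ 2 := by
  simp only [legendreMoment, sq_abs]

theorem abs_zonalIntegral_legendreP_pow_le (n m : ℕ) :
    |zonalIntegral fun t => (legendreP n).eval t ^ m| ≤ legendreMoment n m := by
  rw [zonalIntegral, legendreMoment, zonalIntegral, abs_mul, abs_of_pos Real.two_pi_pos]
  simp only [← abs_pow]
  gcongr
  exact intervalIntegral.abs_integral_le_integral_abs (by norm_num)

theorem abs_contractionK_le (n q r : ℕ) :
    |contractionK n q r| ≤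
      4 * Real.pi * (legendreMoment n (2 * r) * legendreMoment n (q - r) ^ 2) := by
  rw [contractionK_eq_cycleIntegral]
  refine (abs_cycleIntegral_le _ _ _ _).trans
    ((cycleIntegral_alternating_le (by fun_prop) (by fun_prop) fun _ => abs_nonneg _).trans_eq ?_)
  simp only [legendreMoment, zonalIntegral, Pi.pow_apply, abs_pow, ← pow_mul,
    mul_comm 2 r]

theorem abs_contractionK_four_two_le (n : ℕ) :
    |contractionK n 4 2| ≤ 4 * Real.pi * (legendreMoment n 2 * legendreMoment n 3 ^ 2) := by
  rw [contractionK_eq_cycleIntegral, mul_comm (legendreMoment n 2)]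
  refine (abs_cycleIntegral_le _ _ _ _).trans ?_
  simp only [abs_pow]
  exact cycleIntegral_sq_le (f := fun t => |(legendreP n).eval t|) (by fun_prop)
    fun _ => abs_nonneg _

theorem contractionK_one {q : ℕ} (hq : 1 ≤ q) (n : ℕ) :
    contractionK n q 1 = 4 * Real.pi *
      (legendreMoment n 2 * (zonalIntegral fun t => (legendreP n).eval t ^ q) ^ 2) := by
  have hcycle := cycleIntegral_legendreP_eval n (legendreP n ^ (q - 1))
  simp only [eval_pow, pow_sub_one_mul (Nat.one_le_iff_ne_zero.mp hq)] at hcycle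
  rw [contractionK_eq_cycleIntegral, legendreMoment_two, mul_comm (zonalIntegral _), ← hcycle]
  simp only [pow_one]

theorem abs_contractionK_one_le {q : ℕ} (hq : 1 ≤ q) (n : ℕ) :
    |contractionK n q 1| ≤ 4 * Real.pi * (legendreMoment n 2 * legendreMoment n q ^ 2) := by
  have hmoment := legendreMoment_nonneg n 2
  rw [contractionK_one hq, abs_of_nonneg (by positivity)]
  gcongr 4 * Real.pi * (_ * ?_)
  rw [← sq_abs]
  gcongr
  exact abs_zonalIntegral_legendreP_pow_le n q

theorem exists_legendreMoment_le {p : ℝ} (hp : 0 ≤ p) (hp4 : p < 4) :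
    ∃ C, 0 ≤ C ∧ ∀ n m : ℕ, 1 ≤ n → p ≤ m → legendreMoment n m ≤ C * (n : ℝ) ^ (-(p / 2)) := by
  have hgap : 0 < 1 - p / 4 := by linarith
  refine ⟨2 * Real.pi * (2 / (1 - p / 4) * 2 ^ (p / 2)), by positivity, fun n m hn hpm => ?_⟩
  have hmono : ∫ t in (-1 : ℝ)..1, |(legendreP n).eval t| ^ m ≤
      ∫ t in (-1 : ℝ)..1, |(legendreP n).eval t| ^ p := by
    refine intervalIntegral.integral_mono_on (by norm_num)
      (Continuous.intervalIntegrable (by fun_prop) _ _)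
      (Continuous.intervalIntegrable
        (.rpow_const (by fun_prop) fun _ => .inr hp) _ _) fun t ht => ?_
    rw [← Real.rpow_natCast]
    exact Real.rpow_le_rpow_of_exponent_ge' (abs_nonneg _)
      (abs_legendreP_le_one n (abs_le.mpr ht)) hp hpm
  calc legendreMoment n m
      ≤ 2 * Real.pi * (2 / (1 - p / 4) * (2 / n) ^ (p / 2)) := by
        rw [legendreMoment, zonalIntegral]
        gcongr
        exact hmono.trans (integral_abs_legendreP_rpow_le hn hp hp4)
    _ = 2 * Real.pi * (2 / (1 - p / 4) * 2 ^ (p / 2)) * (n : ℝ) ^ (-(p / 2)) := by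
        rw [Real.div_rpow (by norm_num) n.cast_nonneg, Real.rpow_neg n.cast_nonneg]
        ring

theorem exists_legendreMoment_mul_sq_le {p s e : ℝ} (hp : 0 ≤ p) (hp4 : p < 4) (hs : 0 ≤ s)
    (hs4 : s < 4) (he : p / 2 + s = e) : ∃ C, 0 ≤ C ∧ ∀ n a b : ℕ, 1 ≤ n → p ≤ a → s ≤ b →
      4 * Real.pi * (legendreMoment n a * legendreMoment n b ^ 2) ≤ C * (1 / (n : ℝ) ^ e) := by
  obtain ⟨A, hA, hA'⟩ := exists_legendreMoment_le hp hp4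
  obtain ⟨B, -, hB'⟩ := exists_legendreMoment_le hs hs4
  refine ⟨4 * Real.pi * (A * B ^ 2), by positivity, fun n a b hn ha hb => ?_⟩
  have hn0 : (0 : ℝ) < n := by exact_mod_cast hn
  have hpow : (n : ℝ) ^ (-(p / 2)) * ((n : ℝ) ^ (-(s / 2))) ^ 2 = 1 / (n : ℝ) ^ e := by
    rw [← Real.rpow_mul_natCast hn0.le, ← Real.rpow_add hn0, one_div, ← Real.rpow_neg hn0.le, ← he]
    congr 1
    push_cast
    ring
  calc 4 * Real.pi * (legendreMoment n a * legendreMoment n b ^ 2)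
      ≤ 4 * Real.pi * ((A * (n : ℝ) ^ (-(p / 2))) * (B * (n : ℝ) ^ (-(s / 2))) ^ 2) := by
        have := legendreMoment_nonneg n b
        gcongr
        exacts [hA' n a hn ha, hB' n b hn hb]
    _ = 4 * Real.pi * (A * B ^ 2) *
          ((n : ℝ) ^ (-(p / 2)) * ((n : ℝ) ^ (-(s / 2))) ^ 2) := by ring
    _ = 4 * Real.pi * (A * B ^ 2) * (1 / (n : ℝ) ^ e) := by rw [hpow]

theorem exists_abs_contractionK_one_le : ∃ C, 0 ≤ C ∧ ∀ n q : ℕ, 1 ≤ n → 4 ≤ q →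
    |contractionK n q 1| ≤ C * (1 / (n : ℝ) ^ ((9 : ℝ) / 2)) := by
  obtain ⟨C, hC, hbound⟩ := exists_legendreMoment_mul_sq_le (p := 2) (s := 7 / 2)
    (e := 9 / 2) (by norm_num) (by norm_num) (by norm_num) (by norm_num) (by norm_num)
  refine ⟨C, hC, fun n q hn hq => (abs_contractionK_one_le (by lia) n).trans
    (hbound n 2 q hn (by norm_num) ?_)⟩
  have hq4 : (4 : ℝ) ≤ q := by exact_mod_cast hq
  linarith

theorem exists_abs_contractionK_three_one_le : ∃ C, 0 ≤ C ∧ ∀ n : ℕ, 1 ≤ n →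
    |contractionK n 3 1| ≤ C * (1 / (n : ℝ) ^ 5) := by
  obtain ⟨A, hA, hsq⟩ := exists_legendreMoment_le (p := 2) (by norm_num) (by norm_num)
  refine ⟨4 * Real.pi * (A * (2 * Real.pi * 800) ^ 2), by positivity, fun n hn => ?_⟩
  have hcube : |zonalIntegral fun t => (legendreP n).eval t ^ 3| ≤
      2 * Real.pi * (800 / (n : ℝ) ^ 2) := by
    rw [zonalIntegral, abs_mul, abs_of_pos Real.two_pi_pos]
    gcongr
    exact abs_integral_legendreP_cube_le hn
  have hmoment : legendreMoment n 2 ≤ A * (n : ℝ)⁻¹ := by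
    simpa [Real.rpow_neg_one] using hsq n 2 hn (by norm_num)
  have hmoment₀ := legendreMoment_nonneg n 2
  rw [contractionK_one (by norm_num), abs_of_nonneg (by positivity)]
  calc 4 * Real.pi * (legendreMoment n 2 *
        (zonalIntegral fun t => (legendreP n).eval t ^ 3) ^ 2)
      ≤ 4 * Real.pi * (A * (n : ℝ)⁻¹ * (2 * Real.pi * (800 / (n : ℝ) ^ 2)) ^ 2) := by
        rw [← sq_abs (zonalIntegral _)]
        gcongr
    _ = 4 * Real.pi * (A * (2 * Real.pi * 800) ^ 2) * (1 / (n : ℝ) ^ 5) := by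
        field_simp

theorem exists_abs_contractionK_three_le : ∃ C, 0 ≤ C ∧ ∀ n r : ℕ, 1 ≤ n → 1 ≤ r → r ≤ 2 →
    |contractionK n 3 r| ≤ C * (1 / (n : ℝ) ^ 5) := by
  obtain ⟨C, hC, hone⟩ := exists_abs_contractionK_three_one_le
  refine ⟨C, hC, fun n r hn hr hr2 => ?_⟩
  obtain rfl | rfl : r = 1 ∨ r = 2 := by lia
  · exact hone n hn
  · exact contractionK_symm (n := n) (show 2 ≤ 3 by norm_num) ▸ hone n hn

theorem exists_abs_contractionK_four_le : ∃ C, 0 ≤ C ∧ ∀ n r : ℕ, 1 ≤ n → 1 ≤ r → r ≤ 3 →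
    |contractionK n 4 r| ≤ C * (1 / (n : ℝ) ^ 4) := by
  obtain ⟨A, hA, hone⟩ := exists_abs_contractionK_one_le
  obtain ⟨B, hB, htwo⟩ := exists_legendreMoment_mul_sq_le (p := 2) (s := 3)
    (e := (4 : ℕ)) (by norm_num) (by norm_num) (by norm_num) (by norm_num) (by norm_num)
  refine ⟨A + B, by positivity, fun n r hn hr hr3 => ?_⟩
  have hn1 : (1 : ℝ) ≤ n := by exact_mod_cast hn
  wlog hhalf : r ≤ 4 - r
  · rw [contractionK_symm (by lia)]
    exact this A hA hone B hB htwo n (4 - r) hn (by lia) (by lia) hn1 (by lia)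
  obtain rfl | rfl : r = 1 ∨ r = 2 := by lia
  · refine (hone n 4 hn le_rfl).trans ?_
    rw [← Real.rpow_natCast]
    gcongr
    · linarith
    · norm_num
  · refine (abs_contractionK_four_two_le n).trans
      ((htwo n 2 3 hn (by norm_num) (by norm_num)).trans ?_)
    rw [← Real.rpow_natCast]
    gcongr
    linarith

theorem exists_abs_contractionK_le_of_five_le : ∃ C, 0 ≤ C ∧ ∀ n q r : ℕ, 1 ≤ n → 5 ≤ q →
    1 ≤ r → r ≤ q - 1 → |contractionK n q r| ≤ C * (1 / (n : ℝ) ^ ((9 : ℝ) / 2)) := by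
  obtain ⟨A, hA, hone⟩ := exists_abs_contractionK_one_le
  obtain ⟨B, hB, hthree⟩ := exists_legendreMoment_mul_sq_le (p := 3) (s := 3)
    (e := 9 / 2) (by norm_num) (by norm_num) (by norm_num) (by norm_num) (by norm_num)
  refine ⟨A + B, by positivity, fun n q r hn hq hr hrq => ?_⟩
  wlog hhalf : r ≤ q - r
  · rw [contractionK_symm (by lia)]
    exact this A hA hone B hB hthree n q (q - r) hn hq (by lia) (by lia) (by lia)
  obtain rfl | hr2 : r = 1 ∨ 2 ≤ r := by lia
  · refine (hone n q hn (by lia)).trans ?_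
    gcongr
    linarith
  · refine (abs_contractionK_le n q r).trans ((hthree n (2 * r) (q - r) hn
      (by exact_mod_cast (by lia : 3 ≤ 2 * r)) (by exact_mod_cast (by lia : 3 ≤ q - r))).trans ?_)
    gcongr
    linarith

theorem one_div_le_two_mul_log_div {n : ℕ} (hn : 2 ≤ n) {a : ℝ} (ha : 0 ≤ a) :
    1 / a ≤ 2 * (Real.log n / a) := by
  have hlog : Real.log 2 ≤ Real.log n := Real.log_le_log (by norm_num) (by exact_mod_cast hn)
  rw [← mul_div_assoc]
  gcongr
  linarith [Real.log_two_gt_d9]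

theorem exists_abs_contractionK_le_log_of_five_le : ∃ C, 0 ≤ C ∧ ∀ n q r : ℕ, 2 ≤ n → 5 ≤ q →
    1 ≤ r → r ≤ q - 1 →
      |contractionK n q r| ≤ C * (Real.log n / (n : ℝ) ^ ((9 : ℝ) / 2)) := by
  obtain ⟨C, hC, hbound⟩ := exists_abs_contractionK_le_of_five_le
  refine ⟨C * 2, by positivity, fun n q r hn hq hr hrq => ?_⟩
  rw [mul_assoc]
  refine (hbound n q r (by lia) hq hr hrq).trans ?_
  gcongr
  exact one_div_le_two_mul_log_div hn (by positivity)

theorem exists_abs_contractionK_le_of_seven_le : ∃ C, 0 ≤ C ∧ ∀ n q r : ℕ, 1 ≤ n → 7 ≤ q →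
    2 ≤ r → r ≤ q - 2 → |contractionK n q r| ≤ C * (1 / (n : ℝ) ^ 5) := by
  obtain ⟨C, hC, hbound⟩ := exists_legendreMoment_mul_sq_le (p := 10 / 3) (s := 10 / 3)
    (e := (5 : ℕ)) (by norm_num) (by norm_num) (by norm_num) (by norm_num) (by norm_num)
  refine ⟨C, hC, fun n q r hn hq hr hrq => ?_⟩
  wlog hhalf : r ≤ q - r
  · rw [contractionK_symm (by lia)]
    exact this C hC hbound n q (q - r) hn hq (by lia) (by lia) (by lia)
  have hr4 : (4 : ℝ) ≤ (2 * r : ℕ) := by exact_mod_cast (by lia : 4 ≤ 2 * r)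
  have hqr4 : (4 : ℝ) ≤ (q - r : ℕ) := by exact_mod_cast (by lia : 4 ≤ q - r)
  refine (abs_contractionK_le n q r).trans
    ((hbound n (2 * r) (q - r) hn (by linarith) (by linarith)).trans_eq ?_)
  rw [Real.rpow_natCast]

end ContractionBounds

theorem proposition3 :
    ∃ C : ℝ,
      -- `q = 3`
      (∀ r : ℕ, 1 ≤ r → r ≤ 2 → ∀ ℓ : ℕ, 1 ≤ ℓ →
        |contractionK ℓ 3 r| ≤ C * (1 / (ℓ : ℝ) ^ 5)) ∧
      -- `q = 4`
      (∀ r : ℕ, 1 ≤ r → r ≤ 3 → ∀ ℓ : ℕ, 1 ≤ ℓ →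
        |contractionK ℓ 4 r| ≤ C * (1 / (ℓ : ℝ) ^ 4)) ∧
      -- `q = 5, 6`
      (∀ q : ℕ, q = 5 ∨ q = 6 → ∀ r : ℕ, 1 ≤ r → r ≤ q - 1 → ∀ ℓ : ℕ, 2 ≤ ℓ →
        |contractionK ℓ q r| ≤ C * (Real.log (ℓ : ℝ) / (ℓ : ℝ) ^ ((9 : ℝ) / 2))) ∧
      -- `q ≥ 7`
      (∀ q : ℕ, 7 ≤ q →
        (∀ ℓ : ℕ, 1 ≤ ℓ →
          contractionK ℓ q 1 = contractionK ℓ q (q - 1) ∧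
          |contractionK ℓ q 1| ≤ C * (1 / (ℓ : ℝ) ^ ((9 : ℝ) / 2))) ∧
        (∀ r : ℕ, 2 ≤ r → r ≤ q - 2 → ∀ ℓ : ℕ, 1 ≤ ℓ →
          |contractionK ℓ q r| ≤ C * (1 / (ℓ : ℝ) ^ 5))) := by
  obtain ⟨C₃, hC₃, h₃⟩ := exists_abs_contractionK_three_le
  obtain ⟨C₄, hC₄, h₄⟩ := exists_abs_contractionK_four_le
  obtain ⟨C₅, hC₅, h₅⟩ := exists_abs_contractionK_le_log_of_five_le
  obtain ⟨C₁, hC₁, h₁⟩ := exists_abs_contractionK_one_le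
  obtain ⟨C₇, hC₇, h₇⟩ := exists_abs_contractionK_le_of_seven_le
  refine ⟨C₃ + C₄ + C₅ + C₁ + C₇,
    fun r hr hr2 n hn => (h₃ n r hn hr hr2).trans ?_,
    fun r hr hr3 n hn => (h₄ n r hn hr hr3).trans ?_,
    fun q hq r hr hrq n hn => (h₅ n q r hn (by lia) hr hrq).trans ?_,
    fun q hq => ⟨fun n hn => ⟨contractionK_symm (by lia), (h₁ n q hn (by lia)).trans ?_⟩,
      fun r hr hrq n hn => (h₇ n q r hn hq hr hrq).trans ?_⟩⟩
  all_goals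
    gcongr
    linarith
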